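/- Setting. Let $T\ge 1$, $s\ge 0$, let $N_l,K_l$ ($1\le l\le s$) be nonnegative integers, $M_l=\sum_{k=1}^{l}(N_k+K_k)$, $M_0=0$, and put $$\widetilde S=\bigcup_{l=1}^{s}\{-M_l,\dots,-M_{l-1}-N_l-1\},\qquad \Gamma=\widetilde S\cup\{0,1,2,\dots\}.$$ Let $a(j)$, $j\ge 1$, be complex numbers with $\sum_{j\ge 1}|a(j)|<\infty$, let $\vec a(j)=(a(\nu+jT))_{\nu=1}^{T}$ for $j\ge 0$, $A(e^{i\lambda})=\sum_{j\ge0}\vec a(j)e^{ij\lambda}$, and let $\vec{\mathbf a}=(\vec{\mathbf a}(k))_{k\in\Gamma}$ be the sequence with $\vec{\mathbf a}(k)=\vec a(k)$ for $k\ge0$ and $\vec{\mathbf a}(k)=0$ for $k\in\widetilde S$. A spectral density is an integrable function $f$ on $(-\pi,\pi]$ whose values are (a.e.) nonnegative definite Hermitian $T\times T$ matrices. For $\vec b:(-\pi,\pi]\to\mathbb C^T$ write $\|\vec b\|_f^2=\frac1{2\pi}\int_{-\pi}^{\pi}\vec b^{\top}f\,\overline{\vec b}\,d\lambda$. Let $L_2(f)$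 be the space of measurable $\vec b$ with $\|\vec b\|_f<\infty$, and $L_2^s(f)$ its closed subspace generated by the functions $e^{ij\lambda}\delta_\nu$, $1\le\nu\le T$, $j\in\{\dots,-2,-1\}\setminus\widetilde S$, where $\delta_\nu$ is the $\nu$-th unit vector. Put $\Delta(\vec h;f)=\|A-\vec h\|_f^2$ and $\Delta(f)=\inf_{\vec h\in L_2^s(f)}\Delta(\vec h;f)$; an $\vec h\in L_2^s(f)$ that attains the infimum is the spectral characteristic of the optimal linear estimate for $f$. Let $D_f$ be a set of spectral densities, each satisfying the minimality condition: $f(\lambda)$ is invertible for a.e. $\lambda$ and $$\int_{-\pi}^{\pi}\operatorname{Tr}\,[f(\lambda)^{-1}]\,d\lambda<\infty .\qquad (20)$$ A density $f^0\in D_f$ is least favorable in $D_f$ if $\Delta(f^0)=\max_{f\in D_f}\Delta(f)$. Let $H_D=\bigcap_{f\in D_f}L_2^s(f)$; a function $\vec h^0\in H_D$ is a minimax spectral characteristic if $\max_{f\in D_f}\Delta(\vec h^0;f)$ is attained and is at most $\sup_{f\in D_f}\Delta(\vec h;f)$ for every $\vec h\in H_D$. For $f\in D_f$ let $\mathbf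 B=(B(k-j))_{k,j\in\Gamma}$, where $B(k-j)=\frac1{2\pi}\int_{-\pi}^{\pi}[f(\lambda)^{-1}]^{\top}e^{i(j-k)\lambda}\,d\lambda$, acting on finitely supported sequences, and take the closure of this operator in the norm $\langle\mathbf Bx,x\rangle^{1/2}$: $\vec{\mathbf c}=\mathbf B^{-1}\vec{\mathbf a}$ means that there are finitely supported sequences $x_n:\Gamma\to\mathbb C^T$ with $\langle\mathbf B(x_n-x_m),x_n-x_m\rangle\to0$ as $n,m\to\infty$, $x_n(k)\to\vec{\mathbf c}(k)$ and $(\mathbf Bx_n)(k)\to\vec{\mathbf a}(k)$ for all $k\in\Gamma$. Assume that $\mathbf B^{-1}\vec{\mathbf a}$ exists for every $f\in D_f$, and write $\langle\vec{\mathbf c},\vec{\mathbf a}\rangle=\sum_{k\in\Gamma}\vec{\mathbf c}(k)^{\top}\overline{\vec{\mathbf a}(k)}$. Statement. Let $f^0\in D_f$, let $\mathbf B^0$ be the matrix $\mathbf B$ of $f^0$, and suppose that $f^0$ solves the problem $$\max_{f\in D_f}\langle\mathbf B^{-1}\vec{\mathbf a},\vec{\mathbf a}\rangle=\langle(\mathbf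 B^0)^{-1}\vec{\mathbf a},\vec{\mathbf a}\rangle$$ (real parts are compared). Then: (1) $\Delta(\vec h;f)$ is a mean square error: let $f\in D_f$ and let $\zeta$ be a $T$-periodically correlated sequence (zero mean, finite variance, $E\zeta(n+T)\overline{\zeta(m+T)}=E\zeta(n)\overline{\zeta(m)}$ for all $n,m$, with no smaller period) such that the blocked sequence $\vec\zeta(n)=(\zeta(nT+\nu))_{\nu=1}^{T}$ has spectral density $f$, i.e. $E\zeta_\nu(n)\overline{\zeta_\mu(m)}=\frac1{2\pi}\int_{-\pi}^{\pi}e^{i(n-m)\lambda}f_{\nu\mu}(\lambda)\,d\lambda$. Then the series $A\zeta=\sum_{j\ge1}a(j)\zeta(j)$ converges in mean square, every $\vec h\in L_2^s(f)$ defines a linear estimate $\widehat{A\zeta}$ (the mean square limit of $\sum_j p_n(j)^{\top}\vec\zeta(j)$ for trigonometric polynomials $\sum_j p_n(j)e^{ij\lambda}$, $j\in\{\dots,-2,-1\}\setminus\widetilde S$, that converge to $\vec h$ in $L_2(f)$), and $E|A\zeta-\widehat{A\zeta}|^2=\Delta(\vec h;f)$. (2) $f^0$ is least favorable in $D_f$.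 (3) There is an integrable function $C^0:(-\pi,\pi]\to\mathbb C^T$ with Fourier series $\sum_{n\in\Gamma}\vec{\mathbf c}^0(n)e^{in\lambda}$, where $\vec{\mathbf c}^0=(\mathbf B^0)^{-1}\vec{\mathbf a}$, and for every such $C^0$ the function $\vec h(f^0)$ given by $$\vec h(f^0)^{\top}=A^{\top}(e^{i\lambda})-C^0(e^{i\lambda})^{\top}\,[f^0(\lambda)]^{-1}\qquad(17)$$ is the spectral characteristic of the optimal linear estimate for $f^0$. (4) If $D_f$ is convex and $\vec h(f^0)\in H_D$, then $\vec h(f^0)$ is a minimax spectral characteristic. -/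

import Mathlib

open scoped ENNReal ComplexConjugate ComplexOrder

noncomputable section

namespace PCExtrap

open MeasureTheory Filter Topology

/-- Lebesgue measure on `(-π, π]`, the frequency domain. -/
def freq : Measure ℝ := volume.restrict (Set.Ioc (-Real.pi) Real.pi)

/-! ### The pattern of missing observations -/

/-- `M_l = ∑_{k=1}^{l} (N_k + K_k)` (so `M_0 = 0`). -/
def M (N K : ℕ → ℕ) (l : ℕ) : ℕ := ∑ k ∈ Finset.Icc 1 l, (N k + K k)

/-- The missing (blocked) times `⋃_{l=1}^{s} {-M_l, …, -M_{l-1} - N_l - 1}`. -/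
def missing (s : ℕ) (N K : ℕ → ℕ) : Set ℤ :=
  {j | ∃ l ∈ Finset.Icc 1 s, -(M N K l : ℤ) ≤ j ∧ j ≤ -(M N K (l - 1) : ℤ) - (N l : ℤ) - 1}

/-- `Γ`: the missing times together with `{0, 1, 2, …}`. -/
def Gam (s : ℕ) (N K : ℕ → ℕ) : Set ℤ := missing s N K ∪ {j | 0 ≤ j}

/-- The (blocked) times of observation `{…, -2, -1}` without the missing times. -/
def observed (s : ℕ) (N K : ℕ → ℕ) : Set ℤ := {j | j < 0} \ missing s N K

/-! ### Coefficients of the functional -/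

/-- Block coefficients `a_ν(j) = a(ν + jT)`, `ν = 1, …, T`; the index `p : Fin T` is `ν - 1`. -/
def vecCoeff (T : ℕ) (a : ℕ → ℂ) (j : ℕ) : Fin T → ℂ := fun p => a ((p : ℕ) + 1 + j * T)

/-- The sequence of block coefficients, extended by zero to all of `ℤ`
(in particular to the missing times). -/
def extCoeff (T : ℕ) (a : ℕ → ℂ) (k : ℤ) : Fin T → ℂ :=
  if 0 ≤ k then vecCoeff T a k.toNat else 0

/-- `A(e^{iλ}) = ∑_{j ≥ 0} a(j) e^{ijλ}`. -/
def symA (T : ℕ) (a : ℕ → ℂ) (x : ℝ) : Fin T → ℂ := fun p =>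
  ∑' j : ℕ, vecCoeff T a j p * Complex.exp (Complex.I * (j : ℂ) * (x : ℂ))

/-- The vector trigonometric polynomial `∑_j p(j) e^{ijλ}`. -/
def trigPoly {T : ℕ} (p : ℤ →₀ (Fin T → ℂ)) (x : ℝ) : Fin T → ℂ := fun ν =>
  ∑ j ∈ p.support, p j ν * Complex.exp (Complex.I * (j : ℂ) * (x : ℂ))

/-! ### Spectral densities, the spaces `L₂(f)`, `L₂ˢ(f)`, and the mean square error -/

/-- Spectral density matrices: integrable on `(-π, π]`, Hermitian and nonnegative definite. -/
def IsSpectralDensity {T : ℕ} (f : ℝ → Matrix (Fin T) (Fin T) ℂ) : Prop :=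
  (∀ i j, Integrable (fun x => f x i j) freq) ∧ ∀ᵐ x ∂freq, (f x).PosSemidef

/-- The minimality condition `∫ Tr f(λ)⁻¹ dλ < ∞`, which contains that `f(λ)` is invertible for
almost every `λ`. -/
def IsMinimal {T : ℕ} (f : ℝ → Matrix (Fin T) (Fin T) ℂ) : Prop :=
  (∀ᵐ x ∂freq, IsUnit (f x).det) ∧ Integrable (fun x => ((f x)⁻¹).trace) freq

/-- `vᵀ F v̄`, a nonnegative real number when `F` is nonnegative definite. -/
def quad {T : ℕ} (F : Matrix (Fin T) (Fin T) ℂ) (v : Fin T → ℂ) : ℝ :=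
  (∑ ν, ∑ μ, v ν * F ν μ * conj (v μ)).re

/-- `(1/2π) ∫ bᵀ(λ) f(λ) b̄(λ) dλ`, the squared norm of `L₂(f)` (possibly infinite). -/
def normSq {T : ℕ} (f : ℝ → Matrix (Fin T) (Fin T) ℂ) (b : ℝ → Fin T → ℂ) : ℝ≥0∞ :=
  ENNReal.ofReal (1 / (2 * Real.pi)) * ∫⁻ x, ENNReal.ofReal (quad (f x) (b x)) ∂freq

/-- `L₂(f)`. -/
def L2 {T : ℕ} (f : ℝ → Matrix (Fin T) (Fin T) ℂ) : Set (ℝ → Fin T → ℂ) :=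
  {h | AEMeasurable h freq ∧ normSq f h < ∞}

/-- `L₂ˢ(f)`: the closed subspace of `L₂(f)` generated by `e^{ijλ} δ_ν`, `j` a time of
observation. -/
def L2s {T : ℕ} (s : ℕ) (N K : ℕ → ℕ) (f : ℝ → Matrix (Fin T) (Fin T) ℂ) :
    Set (ℝ → Fin T → ℂ) :=
  {h | h ∈ L2 f ∧ ∀ ε : ℝ≥0∞, 0 < ε → ∃ p : ℤ →₀ (Fin T → ℂ),
    (p.support : Set ℤ) ⊆ observed s N K ∧ normSq f (fun x => h x - trigPoly p x) < ε}

/-- `Δ(h; f)`: the mean square error of the estimate with spectral characteristic `h`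
when the spectral density is `f`. -/
def Delta {T : ℕ} (a : ℕ → ℂ) (h : ℝ → Fin T → ℂ) (f : ℝ → Matrix (Fin T) (Fin T) ℂ) : ℝ≥0∞ :=
  normSq f (fun x => symA T a x - h x)

/-- `Δ(f)`: the mean square error of the optimal linear estimate. -/
def DeltaOpt {T : ℕ} (s : ℕ) (N K : ℕ → ℕ) (a : ℕ → ℂ)
    (f : ℝ → Matrix (Fin T) (Fin T) ℂ) : ℝ≥0∞ :=
  ⨅ h ∈ L2s s N K f, Delta a h f

/-- `h` is the spectral characteristic of the optimal linear estimate for the density `f`. -/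
def IsOptimal {T : ℕ} (s : ℕ) (N K : ℕ → ℕ) (a : ℕ → ℂ)
    (f : ℝ → Matrix (Fin T) (Fin T) ℂ) (h : ℝ → Fin T → ℂ) : Prop :=
  h ∈ L2s s N K f ∧ ∀ g ∈ L2s s N K f, Delta a h f ≤ Delta a g f

/-- `f₀` is least favorable in `D`: `Δ(f₀) = max_{f ∈ D} Δ(f)`. -/
def IsLeastFavorable {T : ℕ} (s : ℕ) (N K : ℕ → ℕ) (a : ℕ → ℂ)
    (D : Set (ℝ → Matrix (Fin T) (Fin T) ℂ)) (f₀ : ℝ → Matrix (Fin T) (Fin T) ℂ) : Prop :=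
  f₀ ∈ D ∧ ∀ f ∈ D, DeltaOpt s N K a f ≤ DeltaOpt s N K a f₀

/-- `H_D = ⋂_{f ∈ D} L₂ˢ(f)`. -/
def HD {T : ℕ} (s : ℕ) (N K : ℕ → ℕ) (D : Set (ℝ → Matrix (Fin T) (Fin T) ℂ)) :
    Set (ℝ → Fin T → ℂ) := {h | ∀ f ∈ D, h ∈ L2s s N K f}

/-- `h₀` is minimax: `h₀ ∈ H_D`, the maximum of `Δ(h₀; f)` over `f ∈ D` is attained, and it is
the least among the suprema of `Δ(h; f)` over `f ∈ D`, for `h ∈ H_D`. -/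
def IsMinimax {T : ℕ} (s : ℕ) (N K : ℕ → ℕ) (a : ℕ → ℂ)
    (D : Set (ℝ → Matrix (Fin T) (Fin T) ℂ)) (h₀ : ℝ → Fin T → ℂ) : Prop :=
  h₀ ∈ HD s N K D ∧ (∃ f₁ ∈ D, ∀ f ∈ D, Delta a h₀ f ≤ Delta a h₀ f₁) ∧
    ∀ h ∈ HD s N K D, (⨆ f ∈ D, Delta a h₀ f) ≤ ⨆ f ∈ D, Delta a h f

/-! ### The operator `B` and its inverse -/

/-- `B(k) = (1/2π) ∫ [f(λ)⁻¹]ᵀ e^{-ikλ} dλ`. -/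
def Bcoeff {T : ℕ} (f : ℝ → Matrix (Fin T) (Fin T) ℂ) (k : ℤ) : Matrix (Fin T) (Fin T) ℂ :=
  fun ν μ => (1 / (2 * Real.pi) : ℂ) *
    ∫ x, ((f x)⁻¹).transpose ν μ * Complex.exp (-(Complex.I * (k : ℂ) * (x : ℂ))) ∂freq

/-- `(B x)(k) = ∑_j B(k - j) x(j)` for a finitely supported sequence `x`. -/
def Bapply {T : ℕ} (f : ℝ → Matrix (Fin T) (Fin T) ℂ) (x : ℤ →₀ (Fin T → ℂ)) (k : ℤ) :
    Fin T → ℂ :=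
  ∑ j ∈ x.support, (Bcoeff f (k - j)).mulVec (x j)

/-- `⟨B x, x⟩` for a finitely supported sequence `x`. -/
def Bform {T : ℕ} (f : ℝ → Matrix (Fin T) (Fin T) ℂ) (x : ℤ →₀ (Fin T → ℂ)) : ℝ :=
  (∑ k ∈ x.support, ∑ ν, Bapply f x k ν * conj (x k ν)).re

/-- `c = B⁻¹ y`, where `B = (B(k - j))_{k, j ∈ Γ}`. Under the minimality condition alone the
matrix `B` need not define a bounded operator on `ℓ²` (not even map the unit vectors into `ℓ²`), so
`B` is understood as the closure, in the norm `⟨B x, x⟩^{1/2}`, of the operator that the matrix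
defines on finitely supported sequences: `c` is the coordinatewise limit of finitely supported
sequences `x_n` on `Γ` that are Cauchy in this norm, and `B x_n → y` coordinatewise on `Γ`.
Such a `c` vanishes outside `Γ` by construction. -/
def IsBInv {T : ℕ} (s : ℕ) (N K : ℕ → ℕ) (f : ℝ → Matrix (Fin T) (Fin T) ℂ)
    (y c : ℤ → Fin T → ℂ) : Prop :=
  ∃ x : ℕ → (ℤ →₀ (Fin T → ℂ)),
    (∀ n, ((x n).support : Set ℤ) ⊆ Gam s N K) ∧
    Tendsto (fun q : ℕ × ℕ => Bform f (x q.1 - x q.2)) atTop (𝓝 0) ∧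
    (∀ k, Tendsto (fun n => x n k) atTop (𝓝 (c k))) ∧
    ∀ k ∈ Gam s N K, Tendsto (fun n => Bapply f (x n) k) atTop (𝓝 (y k))

/-- The scalar product `⟨c, y⟩ = ∑_k c(k)ᵀ ȳ(k)`. -/
def pair {T : ℕ} (c y : ℤ → Fin T → ℂ) : ℂ := ∑' k : ℤ, ∑ ν, c k ν * conj (y k ν)

/-- `C(e^{iλ}) = ∑_n c(n) e^{inλ}`, as a Fourier series: `C` is integrable and its Fourier
coefficients are the `c(n)`, `n ∈ ℤ`. -/
def HasFourierSeries {T : ℕ} (C : ℝ → Fin T → ℂ) (c : ℤ → Fin T → ℂ) : Prop :=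
  ∀ ν, Integrable (fun x => C x ν) freq ∧ ∀ k : ℤ,
    (1 / (2 * Real.pi) : ℂ) *
      ∫ x, C x ν * Complex.exp (-(Complex.I * (k : ℂ) * (x : ℂ))) ∂freq = c k ν

/-- The spectral characteristic `hᵀ = Aᵀ(e^{iλ}) - Cᵀ(e^{iλ}) f(λ)⁻¹`. -/
def specChar {T : ℕ} (a : ℕ → ℂ) (f : ℝ → Matrix (Fin T) (Fin T) ℂ) (C : ℝ → Fin T → ℂ) :
    ℝ → Fin T → ℂ :=
  fun x => symA T a x - Matrix.vecMul (C x) ((f x)⁻¹)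

/-! ### Periodically correlated sequences and their linear estimates -/

/-- Covariance `E ζ(n) conj ζ(m)`. -/
def cov {Ω : Type*} [MeasurableSpace Ω] (P : Measure Ω) (ζ : ℤ → Ω → ℂ) (n m : ℤ) : ℂ :=
  ∫ ω, ζ n ω * conj (ζ m ω) ∂P

/-- `T`-periodically correlated sequences: zero mean, finite variance, covariance invariant under
the simultaneous shift by `T` and by no smaller positive integer. -/
structure IsPC {Ω : Type*} [MeasurableSpace Ω] (T : ℕ) (P : Measure Ω) (ζ : ℤ → Ω → ℂ) :
    Prop where
  memLp : ∀ n, MemLp (ζ n) 2 P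
  mean : ∀ n, ∫ ω, ζ n ω ∂P = 0
  periodic : ∀ n m, cov P ζ (n + T) (m + T) = cov P ζ n m
  minimal : ∀ T' : ℕ, 0 < T' → T' < T → ¬ ∀ n m, cov P ζ (n + T') (m + T') = cov P ζ n m

/-- `ζ_ν(n) = ζ(nT + ν)`, `ν = p + 1`: the `T`-blocked sequence. -/
def block {Ω : Type*} {T : ℕ} (ζ : ℤ → Ω → ℂ) (n : ℤ) (p : Fin T) : Ω → ℂ :=
  ζ (n * T + (p : ℕ) + 1)

/-- `f` is the spectral density matrix of the `T`-blocked sequence. -/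
def HasBlockDensity {Ω : Type*} [MeasurableSpace Ω] {T : ℕ} (P : Measure Ω) (ζ : ℤ → Ω → ℂ)
    (f : ℝ → Matrix (Fin T) (Fin T) ℂ) : Prop :=
  ∀ (n m : ℤ) (ν μ : Fin T), ∫ ω, block ζ n ν ω * conj (block ζ m μ ω) ∂P =
    (1 / (2 * Real.pi) : ℂ) *
      ∫ x, Complex.exp (Complex.I * ((n - m : ℤ) : ℂ) * (x : ℂ)) * f x ν μ ∂freq

/-- `E|X - Y|²`. -/
def msDist {Ω : Type*} [MeasurableSpace Ω] (P : Measure Ω) (X Y : Ω → ℂ) : ℝ≥0∞ :=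
  ∫⁻ ω, ENNReal.ofReal (‖X ω - Y ω‖ ^ 2) ∂P

/-- `X = ∑_{j ≥ 1} a(j) ζ(j)`, with convergence in mean square. -/
def IsFunctional {Ω : Type*} [MeasurableSpace Ω] (P : Measure Ω) (a : ℕ → ℂ) (ζ : ℤ → Ω → ℂ)
    (X : Ω → ℂ) : Prop :=
  MemLp X 2 P ∧
    Tendsto (fun n : ℕ => msDist P X (fun ω => ∑ j ∈ Finset.Icc 1 n, a j * ζ (j : ℤ) ω))
      atTop (𝓝 0)

/-- `Y = ∫ hᵀ(e^{iλ}) Z(dλ)`, the linear estimate with spectral characteristic `h`, the stochastic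
integral being the mean square limit of the sums `∑_j pᵀ(j) ζ(j)` over the times of observation for
trigonometric polynomials `∑_j p(j) e^{ijλ}` that approximate `h` in `L₂(f)`. -/
def IsEstimate {Ω : Type*} [MeasurableSpace Ω] {T : ℕ} (s : ℕ) (N K : ℕ → ℕ) (P : Measure Ω)
    (ζ : ℤ → Ω → ℂ) (f : ℝ → Matrix (Fin T) (Fin T) ℂ) (h : ℝ → Fin T → ℂ) (Y : Ω → ℂ) : Prop :=
  MemLp Y 2 P ∧ ∃ p : ℕ → (ℤ →₀ (Fin T → ℂ)),
    (∀ n, ((p n).support : Set ℤ) ⊆ observed s N K) ∧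
    Tendsto (fun n => normSq f (fun x => h x - trigPoly (p n) x)) atTop (𝓝 0) ∧
    Tendsto (fun n => msDist P Y
      (fun ω => ∑ j ∈ (p n).support, ∑ ν, p n j ν * block ζ j ν ω)) atTop (𝓝 0)

end PCExtrap

end

/-!
Everything is transported to the unweighted space `L²((-π, π]; ℂ^T)` by `b ↦ f^{1/2} b`
(`PCExtrap.wt`, `PCExtrap.emb`), where orthogonality and completeness are available. By the
minimality condition `f⁻¹` is again a density of the same kind (`PCExtrap.isSpectralDensity_invd`),
this map is onto, and taking a Fourier coefficient is a continuous functional on `L₂(f)` and on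
`L₂(f⁻¹)`.

The form `⟨Bx, x⟩` is the squared norm in `L₂(f⁻¹)` of the polynomial `∑ x(j) e^{ijλ}`. The
sequence that represents `c = B⁻¹ a` therefore converges in `L₂(f⁻¹)`, and its limit `C` has the
Fourier coefficients `c`, vanishing off `Γ`, while `f⁻¹ᵀ C` has the Fourier coefficients `a` on `Γ`
(`PCExtrap.IsBInv.exists_function`). Put `h = A - f⁻¹ᵀ C`. The error `A - h = f⁻¹ᵀ C` is orthogonal
in `L₂(f)` to the observed frequencies since `c` vanishes there, and the Fourier coefficients of `h`
vanish on `Γ`.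

The main difficulty is that `h` belongs to `L₂ˢ(f)`, i.e. that it is a limit in `L₂(f)` of
trigonometric polynomials with observed frequencies, and not only orthogonal in the unweighted
sense to the other ones (`PCExtrap.mem_L2s_of_fc`). By duality this means that `∑ W_ν conj h_ν` has
mean zero whenever the spectrum of `W` is in `Γ` and that of `h` is off `Γ`. Up to the finite set of
missing times this is a theorem of Smirnov type on the Hardy space `H¹`
(`PCExtrap.H1.sum_mul`): if `∑ h_i w_i` is integrable and all `h_i`, `w_i` are in `H¹`, so is the
sum. It is proved on the circle: if `u² = ∑ (|h_i| + |w_i|)`, and `V` is the analytic function with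
real part `u`, the multipliers `(1 + V/n)⁻¹` of `H¹` are bounded by `1`, tend to `1`, and their
squares make all the factors bounded, so that Parseval's identity applies to the products. The
function `V` is a limit of analytic polynomials, because the `L²` norm of the imaginary part of such
a polynomial with real constant term does not exceed that of its real part.

It follows that `h` is optimal, and `Δ(f) = ⟨c, a⟩` by Parseval's identity
(`PCExtrap.specChar_spec`), whence `f₀` is least favorable. If `D` is convex, the optimal estimates
`h_ε` for `(1 - ε) f₀ + ε f` satisfy `Δ(h_ε; f) ≤ Δ(f₀)` because `f₀` is least favorable, and they
tend to `h` in `L₂(f₀)` by the Pythagorean identity; Fatou's lemma then gives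
`Δ(h; f) ≤ Δ(h; f₀)` (`PCExtrap.delta_le_of_convex`), so `(h, f₀)` is a saddle point. Finally, the
correspondence between trigonometric polynomials and linear combinations of the values of the
sequence is isometric (`PCExtrap.norm_rvPoly_sq`), which identifies `Δ(h; f)` with the mean square
error.
-/

noncomputable section

namespace PCExtrap

open MeasureTheory Filter Topology

/-! ### Characters and Fourier coefficients on `(-π, π]` -/

instance : IsFiniteMeasure freq := by unfold freq; infer_instance

lemma freq_univ : freq.real Set.univ = 2 * Real.pi := by
  simp only [freq, measureReal_def, Measure.restrict_apply_univ, Real.volume_Ioc]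
  rw [ENNReal.toReal_ofReal] <;> linarith [Real.pi_pos]

/-- The character `e^{ikλ}`. -/
def ex (k : ℤ) (x : ℝ) : ℂ := Complex.exp (Complex.I * (k : ℂ) * (x : ℂ))

lemma ex_add (j k : ℤ) (x : ℝ) : ex (j + k) x = ex j x * ex k x := by
  simp only [ex, ← Complex.exp_add]; congr 1; push_cast; ring

@[simp] lemma ex_zero (x : ℝ) : ex 0 x = 1 := by simp [ex]

lemma ex_neg_eq (k : ℤ) (x : ℝ) : Complex.exp (-(Complex.I * (k : ℂ) * (x : ℂ))) = ex (-k) x := by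
  simp only [ex]; congr 1; push_cast; ring

@[simp] lemma norm_ex (k : ℤ) (x : ℝ) : ‖ex k x‖ = 1 := by
  simp [ex, Complex.norm_exp]

lemma conj_ex (k : ℤ) (x : ℝ) : conj (ex k x) = ex (-k) x := by
  simp only [ex, ← Complex.exp_conj]; congr 1; simp

lemma ex_pow (n : ℕ) (x : ℝ) : ex 1 x ^ n = ex n x := by
  simp only [ex, ← Complex.exp_nat_mul]; congr 1; push_cast; ring

lemma ex_mul_ex_neg (k : ℤ) (x : ℝ) : ex k x * ex (-k) x = 1 := by
  rw [← ex_add]; simp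

@[fun_prop] lemma continuous_ex (k : ℤ) : Continuous (ex k) := by
  unfold ex; fun_prop

/-- The unnormalised Fourier coefficient `∫ u(λ) e^{-ikλ} dλ`. -/
def fc (u : ℝ → ℂ) (k : ℤ) : ℂ := ∫ x, u x * ex (-k) x ∂freq

lemma integrable_mul_ex {u : ℝ → ℂ} (hu : Integrable u freq) (k : ℤ) :
    Integrable (fun x => u x * ex k x) freq := by
  refine hu.mul_bdd (c := 1) (continuous_ex k).aestronglyMeasurable ?_
  simp

lemma fc_add {u v : ℝ → ℂ} (hu : Integrable u freq) (hv : Integrable v freq) (k : ℤ) :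
    fc (fun x => u x + v x) k = fc u k + fc v k := by
  simp only [fc, add_mul]
  exact integral_add (integrable_mul_ex hu _) (integrable_mul_ex hv _)

lemma fc_sub {u v : ℝ → ℂ} (hu : Integrable u freq) (hv : Integrable v freq) (k : ℤ) :
    fc (fun x => u x - v x) k = fc u k - fc v k := by
  simp only [fc, sub_mul]
  exact integral_sub (integrable_mul_ex hu _) (integrable_mul_ex hv _)

lemma fc_const_mul (u : ℝ → ℂ) (a : ℂ) (k : ℤ) :
    fc (fun x => a * u x) k = a * fc u k := by
  simp only [fc, mul_assoc]
  exact integral_const_mul _ _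

lemma fc_sum {ι : Type*} (s : Finset ι) {u : ι → ℝ → ℂ} (hu : ∀ i ∈ s, Integrable (u i) freq)
    (k : ℤ) : fc (fun x => ∑ i ∈ s, u i x) k = ∑ i ∈ s, fc (u i) k := by
  simp only [fc, Finset.sum_mul]
  exact integral_finsetSum _ fun i hi => integrable_mul_ex (hu i hi) _

lemma fc_congr {u v : ℝ → ℂ} (h : u =ᵐ[freq] v) (k : ℤ) : fc u k = fc v k := by
  refine integral_congr_ae ?_
  filter_upwards [h] with x hx
  rw [hx]

lemma fc_mul_ex (u : ℝ → ℂ) (j k : ℤ) : fc (fun x => u x * ex j x) k = fc u (k - j) := by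
  simp only [fc, mul_assoc, ← ex_add]
  rw [show -(k - j) = j + -k by ring]

lemma fc_conj (u : ℝ → ℂ) (k : ℤ) : fc (fun x => conj (u x)) k = conj (fc u (-k)) := by
  rw [fc, fc, ← integral_conj]
  congr 1; ext x
  rw [map_mul, conj_ex, neg_neg (-k)]

lemma integral_ex (k : ℤ) : ∫ x, ex k x ∂freq = if k = 0 then (2 * Real.pi : ℂ) else 0 := by
  split_ifs with h
  · subst h
    simp [freq_univ]
  · have hI : Complex.I * (k : ℂ) ≠ 0 := mul_ne_zero Complex.I_ne_zero (by exact_mod_cast h)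
    have h1 : ∫ x in (-Real.pi)..Real.pi, Complex.exp (Complex.I * (k : ℂ) * (x : ℂ)) = 0 := by
      rw [integral_exp_mul_complex hI]
      have : Complex.exp (Complex.I * (k : ℂ) * (Real.pi : ℂ)) =
          Complex.exp (Complex.I * (k : ℂ) * ((-Real.pi : ℝ) : ℂ)) := by
        rw [Complex.exp_eq_exp_iff_exists_int]
        exact ⟨k, by push_cast; ring⟩
      rw [this]; simp
    rwa [intervalIntegral.integral_of_le (by linarith [Real.pi_pos])] at h1

lemma fc_ex (j k : ℤ) : fc (ex j) k = if k = j then (2 * Real.pi : ℂ) else 0 := by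
  simp only [fc, ← ex_add, integral_ex]
  congr 1
  simp only [eq_iff_iff]
  constructor <;> intro h <;> linarith

lemma tendsto_fc_of_dominated {F : ℕ → ℝ → ℂ} {f : ℝ → ℂ} {b : ℝ → ℝ}
    (hF : ∀ n, AEStronglyMeasurable (F n) freq) (hb : Integrable b freq)
    (hFb : ∀ n, ∀ᵐ x ∂freq, ‖F n x‖ ≤ b x)
    (hlim : ∀ᵐ x ∂freq, Tendsto (fun n => F n x) atTop (𝓝 (f x))) (k : ℤ) :
    Tendsto (fun n => fc (F n) k) atTop (𝓝 (fc f k)) := by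
  refine tendsto_integral_of_dominated_convergence b ?_ hb ?_ ?_
  · exact fun n => (hF n).mul (continuous_ex _).aestronglyMeasurable
  · intro n
    filter_upwards [hFb n] with x hx
    simpa using hx
  · filter_upwards [hlim] with x hx
    exact hx.mul_const _

/-! ### Analytic integrable functions and their multipliers -/

/-- The boundary functions of the Hardy space `H¹`: integrable functions whose Fourier
coefficients of negative index vanish. -/
def H1 (u : ℝ → ℂ) : Prop := Integrable u freq ∧ ∀ k < 0, fc u k = 0

lemma H1.add {u v : ℝ → ℂ} (hu : H1 u) (hv : H1 v) : H1 (fun x => u x + v x) :=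
  ⟨hu.1.add hv.1, fun k hk => by rw [fc_add hu.1 hv.1, hu.2 k hk, hv.2 k hk, add_zero]⟩

lemma H1.const_mul {u : ℝ → ℂ} (hu : H1 u) (a : ℂ) : H1 (fun x => a * u x) :=
  ⟨hu.1.const_mul a, fun k hk => by rw [fc_const_mul, hu.2 k hk, mul_zero]⟩

lemma H1.sum {ι : Type*} {s : Finset ι} {u : ι → ℝ → ℂ} (hu : ∀ i ∈ s, H1 (u i)) :
    H1 (fun x => ∑ i ∈ s, u i x) :=
  ⟨integrable_finsetSum _ fun i hi => (hu i hi).1, fun k hk => by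
    rw [fc_sum _ fun i hi => (hu i hi).1]
    exact Finset.sum_eq_zero fun i hi => (hu i hi).2 k hk⟩

lemma H1.mul_ex {u : ℝ → ℂ} (hu : H1 u) (n : ℕ) : H1 (fun x => u x * ex n x) :=
  ⟨integrable_mul_ex hu.1 _, fun k hk => by rw [fc_mul_ex]; exact hu.2 _ (by omega)⟩

lemma H1.congr {u v : ℝ → ℂ} (hu : H1 u) (h : u =ᵐ[freq] v) : H1 v :=
  ⟨hu.1.congr h, fun k hk => by rw [← fc_congr h]; exact hu.2 k hk⟩

lemma H1.of_tendsto {F : ℕ → ℝ → ℂ} {f : ℝ → ℂ} {b : ℝ → ℝ}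
    (hF : ∀ n, H1 (F n)) (hb : Integrable b freq)
    (hFb : ∀ n, ∀ᵐ x ∂freq, ‖F n x‖ ≤ b x)
    (hlim : ∀ᵐ x ∂freq, Tendsto (fun n => F n x) atTop (𝓝 (f x))) : H1 f := by
  have hm : ∀ n, AEStronglyMeasurable (F n) freq := fun n => (hF n).1.1
  refine ⟨hb.mono' (aestronglyMeasurable_of_tendsto_ae _ hm hlim) ?_, fun k hk => ?_⟩
  · filter_upwards [hlim, ae_all_iff.2 hFb] with x hx hbx
    exact le_of_tendsto hx.norm (Eventually.of_forall hbx)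
  · refine tendsto_nhds_unique (tendsto_fc_of_dominated hm hb hFb hlim k) ?_
    simp only [(hF _).2 k hk]
    exact tendsto_const_nhds

/-- Measurable multipliers of `H¹`. -/
def MulH1 (φ : ℝ → ℂ) : Prop :=
  AEStronglyMeasurable φ freq ∧ ∀ u, H1 u → H1 (fun x => φ x * u x)

lemma MulH1.mul {φ ψ : ℝ → ℂ} (hφ : MulH1 φ) (hψ : MulH1 ψ) : MulH1 (fun x => φ x * ψ x) :=
  ⟨hφ.1.mul hψ.1, fun u hu => by simpa only [mul_assoc] using hφ.2 _ (hψ.2 u hu)⟩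

lemma MulH1.of_tendsto {φ : ℕ → ℝ → ℂ} {ψ : ℝ → ℂ} {M : ℝ} (hφ : ∀ n, MulH1 (φ n))
    (hM : ∀ n, ∀ᵐ x ∂freq, ‖φ n x‖ ≤ M)
    (hlim : ∀ᵐ x ∂freq, Tendsto (fun n => φ n x) atTop (𝓝 (ψ x))) : MulH1 ψ := by
  refine ⟨aestronglyMeasurable_of_tendsto_ae _ (fun n => (hφ n).1) hlim, fun u hu => ?_⟩
  refine H1.of_tendsto (b := fun x => M * ‖u x‖) (fun n => (hφ n).2 u hu)
    (hu.1.norm.const_mul M) (fun n => ?_) ?_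
  · filter_upwards [hM n] with x hx
    rw [norm_mul]
    gcongr
  · filter_upwards [hlim] with x hx
    exact hx.mul_const _

lemma continuous_poly (P : Polynomial ℂ) : Continuous (fun x => P.eval (ex 1 x)) :=
  P.continuous.comp (continuous_ex 1)

lemma MulH1.poly (P : Polynomial ℂ) : MulH1 (fun x => P.eval (ex 1 x)) := by
  refine ⟨(continuous_poly P).aestronglyMeasurable, fun u hu => ?_⟩
  have : (fun x => P.eval (ex 1 x) * u x) =
      fun x => ∑ n ∈ P.support, P.coeff n * (u x * ex n x) := by
    ext x
    rw [Polynomial.eval_eq_sum, Polynomial.sum_def, Finset.sum_mul]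
    refine Finset.sum_congr rfl fun n _ => ?_
    rw [ex_pow]; ring
  rw [this]
  exact H1.sum fun n _ => (hu.mul_ex n).const_mul _

lemma exists_norm_poly_le (P : Polynomial ℂ) : ∃ R : ℝ, 1 ≤ R ∧ ∀ x, ‖P.eval (ex 1 x)‖ ≤ R := by
  obtain ⟨R, hR⟩ := (isCompact_sphere (0 : ℂ) 1).exists_bound_of_continuousOn
    P.continuous.continuousOn
  exact ⟨max R 1, le_max_right _ _, fun x => (hR _ (by simp)).trans (le_max_left _ _)⟩

/-- The reciprocal of an analytic polynomial with real part at least `1/2` is a multiplier,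
as the uniform limit of the Neumann series `δ ∑ (1 - δ P)^j` for small `δ > 0`. -/
lemma MulH1.inv_poly (P : Polynomial ℂ) (hP : ∀ x, 1 / 2 ≤ (P.eval (ex 1 x)).re) :
    MulH1 (fun x => (P.eval (ex 1 x))⁻¹) := by
  obtain ⟨R, hR1, hR⟩ := exists_norm_poly_le P
  set δ : ℝ := 1 / (2 * R ^ 2) with hδ
  have hδ0 : 0 < δ := by positivity
  have hδR : δ * R ^ 2 = 1 / 2 := by rw [hδ]; field_simp
  have hlt : ∀ x, ‖1 - (δ : ℂ) * P.eval (ex 1 x)‖ < 1 := by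
    intro x
    have h1 : ‖1 - (δ : ℂ) * P.eval (ex 1 x)‖ ^ 2 =
        1 - 2 * δ * (P.eval (ex 1 x)).re + δ ^ 2 * ‖P.eval (ex 1 x)‖ ^ 2 := by
      rw [← Complex.normSq_eq_norm_sq, ← Complex.normSq_eq_norm_sq]
      simp [Complex.normSq_apply]; ring
    have h2 : ‖P.eval (ex 1 x)‖ ^ 2 ≤ R ^ 2 := by
      have := hR x; gcongr
    have h3 : δ ^ 2 * ‖P.eval (ex 1 x)‖ ^ 2 ≤ δ / 2 := by
      calc δ ^ 2 * ‖P.eval (ex 1 x)‖ ^ 2 ≤ δ ^ 2 * R ^ 2 := by gcongr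
        _ = δ / 2 := by rw [sq δ, mul_assoc, hδR]; ring
    have h4 := mul_le_mul_of_nonneg_left (hP x) hδ0.le
    nlinarith [norm_nonneg (1 - (δ : ℂ) * P.eval (ex 1 x))]
  have hne : ∀ x, P.eval (ex 1 x) ≠ 0 := fun x h => by
    have := hP x; rw [h] at this; norm_num at this
  have hinv : ∀ x, ‖(P.eval (ex 1 x))⁻¹‖ ≤ 2 := fun x => by
    rw [norm_inv, inv_le_comm₀ (norm_pos_iff.2 (hne x)) two_pos]
    exact le_trans (by simpa using hP x) (Complex.re_le_norm _)
  have hgeom : ∀ (n : ℕ) x, (Polynomial.C (δ : ℂ) *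
      ∑ j ∈ Finset.range n, (1 - Polynomial.C (δ : ℂ) * P) ^ j).eval (ex 1 x) =
      (1 - (1 - (δ : ℂ) * P.eval (ex 1 x)) ^ n) * (P.eval (ex 1 x))⁻¹ := by
    intro n x
    have h := geom_sum_mul (1 - (δ : ℂ) * P.eval (ex 1 x)) n
    simp only [Polynomial.eval_mul, Polynomial.eval_C, Polynomial.eval_finsetSum,
      Polynomial.eval_pow, Polynomial.eval_sub, Polynomial.eval_one]
    rw [eq_mul_inv_iff_mul_eq₀ (hne x)]
    linear_combination -h
  refine MulH1.of_tendsto (M := 4) (fun n => MulH1.poly (Polynomial.C (δ : ℂ) *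
      ∑ j ∈ Finset.range n, (1 - Polynomial.C (δ : ℂ) * P) ^ j))
    (fun n => .of_forall fun x => ?_) (.of_forall fun x => ?_)
  · rw [hgeom, norm_mul]
    have h1 : ‖1 - (1 - (δ : ℂ) * P.eval (ex 1 x)) ^ n‖ ≤ 2 := by
      refine (norm_sub_le _ _).trans ?_
      have := pow_le_one₀ (n := n) (norm_nonneg _) (hlt x).le
      rw [norm_one, norm_pow]; linarith
    nlinarith [hinv x, norm_nonneg (1 - (1 - (δ : ℂ) * P.eval (ex 1 x)) ^ n),
      norm_nonneg (P.eval (ex 1 x))⁻¹]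
  · simp only [hgeom]
    have := (tendsto_pow_atTop_nhds_zero_of_norm_lt_one (hlt x)).const_sub 1
    simpa using this.mul_const (P.eval (ex 1 x))⁻¹

/-! ### Completeness of the characters -/

instance : Fact (0 < 2 * Real.pi) := ⟨by positivity⟩

lemma fourier_coe_eq_ex (k : ℤ) (x : ℝ) :
    fourier k (x : AddCircle (2 * Real.pi)) = ex k x := by
  rw [fourier_coe_apply, ex]
  congr 1
  have : (Real.pi : ℂ) ≠ 0 := by exact_mod_cast Real.pi_ne_zero
  push_cast
  field_simp

lemma freq_eq : freq = volume.restrict (Set.Ioc (-Real.pi) (-Real.pi + 2 * Real.pi)) := by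
  rw [freq]; congr 2; ring

lemma measurePreserving_coe :
    MeasurePreserving (fun x : ℝ => (x : AddCircle (2 * Real.pi))) freq volume := by
  rw [freq_eq]; exact AddCircle.measurePreserving_mk _ _

lemma fourierCoeff_liftIoc (u : ℝ → ℂ) (k : ℤ) :
    fourierCoeff (AddCircle.liftIoc (2 * Real.pi) (-Real.pi) u) k =
      (1 / (2 * Real.pi)) * fc u k := by
  rw [fourierCoeff_eq_intervalIntegral _ _ (-Real.pi),
    intervalIntegral.integral_of_le (by linarith [Real.pi_pos]), fc, freq_eq, Complex.real_smul]
  congr 1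
  · push_cast; rfl
  · refine setIntegral_congr_fun measurableSet_Ioc fun x hx => ?_
    simp only [fourier_coe_eq_ex, smul_eq_mul]
    rw [AddCircle.liftIoc_coe_apply hx, mul_comm]

/-- The product of two square integrable functions has mean zero if their Fourier coefficients of
opposite indices never interact. -/
lemma integral_mul_eq_zero_of_fc {F G : ℝ → ℂ} (hF : MemLp F 2 freq) (hG : MemLp G 2 freq)
    (h : ∀ k, fc F (-k) = 0 ∨ fc G k = 0) : ∫ x, F x * G x ∂freq = 0 := by
  have hlift : ∀ {u : ℝ → ℂ}, MemLp u 2 freq →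
      ∃ v : Lp ℂ 2 (AddCircle.haarAddCircle (T := 2 * Real.pi)),
      v =ᵐ[AddCircle.haarAddCircle] AddCircle.liftIoc (2 * Real.pi) (-Real.pi) u := by
    intro u hu
    rw [freq_eq] at hu
    exact ⟨_, hu.memLp_liftIoc.haarAddCircle.coeFn_toLp⟩
  have hFc : MemLp (fun x => conj (F x)) 2 freq := hF.star
  obtain ⟨f, hf⟩ := hlift hFc
  obtain ⟨g, hg⟩ := hlift hG
  have key := (fourierBasis (T := 2 * Real.pi)).hasSum_inner_mul_inner f g
  have hz : ∀ k, inner ℂ f (fourierBasis (T := 2 * Real.pi) k) *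
      inner ℂ (fourierBasis (T := 2 * Real.pi) k) g = 0 := by
    intro k
    rw [← inner_conj_symm, ← HilbertBasis.repr_apply_apply, ← HilbertBasis.repr_apply_apply,
      fourierBasis_repr, fourierBasis_repr, fourierCoeff_congr_ae hf,
      fourierCoeff_congr_ae hg, fourierCoeff_liftIoc, fourierCoeff_liftIoc, fc_conj]
    rcases h k with h | h <;> simp [h]
  simp only [hz] at key
  have h0 := key.unique hasSum_zero
  rw [L2.inner_def] at h0
  have h1 : ∫ t, inner ℂ (f t) (g t) ∂AddCircle.haarAddCircle =
      ∫ t, AddCircle.liftIoc (2 * Real.pi) (-Real.pi) (fun x => F x * G x) t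
        ∂AddCircle.haarAddCircle := by
    refine integral_congr_ae ?_
    filter_upwards [hf, hg] with t h1 h2
    rw [h1, h2]
    simp only [AddCircle.liftIoc, RCLike.inner_apply', Function.comp, Set.domRestrict]
    simp
  rw [h1, AddCircle.integral_haarAddCircle,
    AddCircle.integral_liftIoc_eq_intervalIntegral,
    intervalIntegral.integral_of_le (by linarith [Real.pi_pos]), ← freq_eq] at h0
  simpa [Real.pi_ne_zero] using h0

/-- Products of square integrable functions in `H¹` are in `H¹`. -/
lemma H1.mul_of_memLp {F G : ℝ → ℂ} (hF : H1 F) (hG : H1 G) (hF2 : MemLp F 2 freq)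
    (hG2 : MemLp G 2 freq) : H1 (fun x => F x * G x) := by
  refine ⟨hF2.integrable_mul hG2, fun k hk => ?_⟩
  have h2 : MemLp (fun x => G x * ex (-k) x) 2 freq := by
    refine hG2.of_le (hG2.1.mul (continuous_ex _).aestronglyMeasurable) (.of_forall fun x => ?_)
    simp
  simp only [fc, mul_assoc]
  refine integral_mul_eq_zero_of_fc hF2 h2 fun j => ?_
  rw [fc_mul_ex]
  by_cases hj : 0 < j
  · exact Or.inl (hF.2 _ (by omega))
  · exact Or.inr (hG.2 _ (by omega))

lemma integral_mul_continuous_eq_zero {u : ℝ → ℂ} (hu : Integrable u freq) (h : ∀ k, fc u k = 0)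
    (v : C(AddCircle (2 * Real.pi), ℂ)) : ∫ x, v x * u x ∂freq = 0 := by
  have hmeas : ∀ v : C(AddCircle (2 * Real.pi), ℂ),
      AEStronglyMeasurable (fun x : ℝ => v x) freq := fun v =>
    (v.continuous.comp (AddCircle.continuous_mk' _)).aestronglyMeasurable
  have hint : ∀ v : C(AddCircle (2 * Real.pi), ℂ), Integrable (fun x : ℝ => v x * u x) freq :=
    fun v => hu.bdd_mul (c := ‖v‖) (hmeas v) (.of_forall fun x => v.norm_coe_le_norm _)
  let L : C(AddCircle (2 * Real.pi), ℂ) →ₗ[ℂ] ℂ :=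
    { toFun := fun v => ∫ x, v x * u x ∂freq
      map_add' := fun v w => by
        simp only [ContinuousMap.add_apply, add_mul]
        exact integral_add (hint v) (hint w)
      map_smul' := fun a v => by
        simp only [ContinuousMap.smul_apply, smul_eq_mul, mul_assoc, RingHom.id_apply]
        exact integral_const_mul _ _ }
  have hL : Continuous L := by
    refine (L.mkContinuous (∫ x, ‖u x‖ ∂freq) fun v => ?_).continuous
    refine (norm_integral_le_integral_norm _).trans ?_
    rw [← integral_mul_const]
    refine integral_mono (hint v).norm (hu.norm.mul_const _) fun x => ?_
    simp only [norm_mul]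
    rw [mul_comm]
    gcongr
    exact v.norm_coe_le_norm _
  have hspan : Submodule.span ℂ (Set.range (fourier (T := 2 * Real.pi))) ≤ LinearMap.ker L := by
    rw [Submodule.span_le]
    rintro _ ⟨k, rfl⟩
    change ∫ x, fourier k (x : AddCircle (2 * Real.pi)) * u x ∂freq = 0
    simp only [fourier_coe_eq_ex]
    rw [← h (-k), fc]
    simp only [neg_neg, mul_comm]
  have hclosed : IsClosed (LinearMap.ker L : Set C(AddCircle (2 * Real.pi), ℂ)) :=
    isClosed_singleton.preimage hL
  have := Submodule.topologicalClosure_minimal _ hspan hclosed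
  rw [span_fourier_closure_eq_top] at this
  exact this (Submodule.mem_top (x := v))

/-- An integrable function is determined by its Fourier coefficients. -/
lemma ae_eq_zero_of_fc {u : ℝ → ℂ} (hu : Integrable u freq) (h : ∀ k, fc u k = 0) :
    u =ᵐ[freq] 0 := by
  have key := isOpen_Ioo (a := -Real.pi) (b := Real.pi).ae_eq_zero_of_integral_contDiff_smul_eq_zero
    (μ := volume) (f := u) ?_ ?_
  · rw [freq, ← restrict_Ioo_eq_restrict_Ioc]
    exact (ae_restrict_iff' measurableSet_Ioo).2 key
  · exact (IntegrableOn.mono_set (μ := volume) hu Set.Ioo_subset_Ioc_self).locallyIntegrableOn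
  · intro g hg _ hsupp
    have hg0 : ∀ x, x ∉ Set.Ioo (-Real.pi) Real.pi → g x = 0 := fun x hx => by
      by_contra h0
      exact hx (hsupp (subset_tsupport _ h0))
    have hc : Continuous (AddCircle.liftIoc (2 * Real.pi) (-Real.pi) fun x => (g x : ℂ)) := by
      refine AddCircle.liftIoc_continuous ?_ ?_
      · rw [hg0 _ (by simp), hg0 _ (by simp only [Set.mem_Ioo]; intro h; linarith [h.2])]
      · exact (Complex.continuous_ofReal.comp hg.continuous).continuousOn
    have h0 := integral_mul_continuous_eq_zero hu h ⟨_, hc⟩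
    have h1 : ∫ x, g x • u x = ∫ x in Set.Ioc (-Real.pi) Real.pi, g x • u x := by
      rw [setIntegral_eq_integral_of_forall_compl_eq_zero]
      intro x hx
      rw [hg0 x fun hx' => hx (Set.Ioo_subset_Ioc_self hx'), zero_smul]
    rw [h1, ← h0, freq]
    refine setIntegral_congr_fun measurableSet_Ioc fun x hx => ?_
    simp only [ContinuousMap.coe_mk]
    rw [AddCircle.liftIoc_coe_apply]
    · simp
    · rwa [show -Real.pi + 2 * Real.pi = Real.pi by ring]

/-- Real continuous periodic functions are uniform limits of real parts of analytic
polynomials. -/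
lemma exists_poly_re_near (v : C(AddCircle (2 * Real.pi), ℝ)) {ε : ℝ} (hε : 0 < ε) :
    ∃ P : Polynomial ℂ, (P.coeff 0).im = 0 ∧ ∀ x : ℝ, |(P.eval (ex 1 x)).re - v x| < ε := by
  have hmem : ∀ s ∈ Submodule.span ℂ (Set.range (fourier (T := 2 * Real.pi))), ∀ a : ℂ,
      ∃ P : Polynomial ℂ, ∀ x : ℝ, (P.eval (ex 1 x)).re = (a * s x).re := by
    intro s hs
    induction hs using Submodule.span_induction with
    | mem s hs =>
      obtain ⟨k, rfl⟩ := hs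
      intro a
      obtain ⟨n, rfl | rfl⟩ := k.eq_nat_or_neg
      · exact ⟨Polynomial.C a * Polynomial.X ^ n, fun x => by
          simp only [fourier_coe_eq_ex, Polynomial.eval_mul, Polynomial.eval_C,
            Polynomial.eval_pow, Polynomial.eval_X, ex_pow]⟩
      · refine ⟨Polynomial.C (conj a) * Polynomial.X ^ n, fun x => ?_⟩
        simp only [fourier_coe_eq_ex, Polynomial.eval_mul, Polynomial.eval_C,
          Polynomial.eval_pow, Polynomial.eval_X, ex_pow]
        rw [← conj_ex, ← Complex.conj_re, map_mul, Complex.conj_conj]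
    | zero => exact fun a => ⟨0, by simp⟩
    | add s t _ _ hs ht =>
      intro a
      obtain ⟨P, hP⟩ := hs a
      obtain ⟨Q, hQ⟩ := ht a
      exact ⟨P + Q, fun x => by simp [hP, hQ, mul_add]⟩
    | smul b s _ hs =>
      intro a
      obtain ⟨P, hP⟩ := hs (a * b)
      exact ⟨P, fun x => by simp [hP, mul_assoc]⟩
  let w : C(AddCircle (2 * Real.pi), ℂ) := ⟨fun t => (v t : ℂ), by fun_prop⟩
  have hw : w ∈ (Submodule.span ℂ (Set.range (fourier (T := 2 * Real.pi)))).topologicalClosure := by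
    rw [span_fourier_closure_eq_top]; trivial
  obtain ⟨s, hs, hsw⟩ := Metric.mem_closure_iff.1 hw ε hε
  obtain ⟨P, hP⟩ := hmem s hs 1
  refine ⟨P - Polynomial.C (((P.coeff 0).im : ℂ) * Complex.I), by simp, fun x => ?_⟩
  have h1 := (ContinuousMap.dist_apply_le_dist (f := w) (g := s)
    (x := (x : AddCircle _))).trans_lt hsw
  rw [dist_comm, dist_eq_norm] at h1
  refine lt_of_le_of_lt ?_ h1
  refine le_trans (le_of_eq ?_) (Complex.abs_re_le_norm _)
  simp [hP, w]

/-! ### Squares of `L²` seminorms and almost everywhere convergent subsequences -/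

lemma eLpNorm_two_sq {α E : Type*} [MeasurableSpace α] [NormedAddCommGroup E] (μ : Measure α)
    (f : α → E) : eLpNorm f 2 μ ^ 2 = ∫⁻ x, ENNReal.ofReal (‖f x‖ ^ 2) ∂μ := by
  have h := eLpNorm_nnreal_pow_eq_lintegral (f := f) (μ := μ) (p := 2) two_ne_zero
  simp only [NNReal.coe_ofNat, ENNReal.coe_ofNat, ENNReal.rpow_ofNat] at h
  rw [h]
  refine lintegral_congr fun x => ?_
  rw [← ofReal_norm, ENNReal.ofReal_pow (norm_nonneg _)]

lemma exists_subseq_tendsto_ae {α E : Type*} [MeasurableSpace α] [NormedAddCommGroup E]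
    {μ : Measure α} {p : ℝ≥0∞} (hp : p ≠ 0) {f : ℕ → α → E} {g : α → E}
    (hf : ∀ n, AEStronglyMeasurable (f n) μ) (hg : AEStronglyMeasurable g μ)
    (h : Tendsto (fun n => eLpNorm (f n - g) p μ) atTop (𝓝 0)) :
    ∃ ns : ℕ → ℕ, StrictMono ns ∧ ∀ᵐ x ∂μ, Tendsto (fun i => f (ns i) x) atTop (𝓝 (g x)) :=
  (tendstoInMeasure_of_tendsto_eLpNorm hp hf hg h).exists_seq_tendsto_ae

/-! ### Analytic completion of a nonnegative function -/

lemma integral_poly (P : Polynomial ℂ) :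
    ∫ x, P.eval (ex 1 x) ∂freq = 2 * Real.pi * P.coeff 0 := by
  have h : ∀ x, P.eval (ex 1 x) = ∑ n ∈ P.support, P.coeff n * ex n x := fun x => by
    simp only [Polynomial.eval_eq_sum, Polynomial.sum_def, ex_pow]
  have hint : ∀ n : ℕ, Integrable (ex n) freq := fun n => by
    simpa using integrable_mul_ex (integrable_const (1 : ℂ)) n
  simp only [h]
  rw [integral_finsetSum _ fun n _ => (hint n).const_mul _]
  simp only [integral_const_mul, integral_ex, Nat.cast_eq_zero, mul_ite, mul_zero]
  rw [Finset.sum_ite_eq']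
  split_ifs with h0
  · ring
  · rw [Polynomial.notMem_support_iff.1 h0]; ring

/-- The imaginary part of an analytic polynomial with real constant term is controlled by its real
part, since the square of the polynomial has mean `P(0)² ≥ 0`. -/
lemma eLpNorm_poly_le (P : Polynomial ℂ) (hP : (P.coeff 0).im = 0) :
    eLpNorm (fun x => P.eval (ex 1 x)) 2 freq ≤
      2 * eLpNorm (fun x => (P.eval (ex 1 x)).re) 2 freq := by
  have hc := continuous_poly P
  obtain ⟨R, -, hR⟩ := exists_norm_poly_le P
  have hbd : ∀ {g : ℝ → ℝ}, Continuous g → (∀ x, |g x| ≤ ‖P.eval (ex 1 x)‖) →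
      Integrable (fun x => g x ^ 2) freq := by
    intro g hg hgb
    refine Integrable.of_bound (hg.pow 2).aestronglyMeasurable (R ^ 2) (.of_forall fun x => ?_)
    rw [norm_pow, Real.norm_eq_abs]
    gcongr
    exact (hgb x).trans (hR x)
  have hre : Integrable (fun x => (P.eval (ex 1 x)).re ^ 2) freq :=
    hbd (Complex.continuous_re.comp hc) fun x => Complex.abs_re_le_norm _
  have him : Integrable (fun x => (P.eval (ex 1 x)).im ^ 2) freq :=
    hbd (Complex.continuous_im.comp hc) fun x => Complex.abs_im_le_norm _
  have hnorm : Integrable (fun x => ‖P.eval (ex 1 x)‖ ^ 2) freq :=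
    hbd hc.norm fun x => by simp
  have hsq : 0 ≤ ∫ x, ((P.eval (ex 1 x)).re ^ 2 - (P.eval (ex 1 x)).im ^ 2) ∂freq := by
    have h1 := integral_poly (P ^ 2)
    have h2 : Integrable (fun x => (P ^ 2).eval (ex 1 x)) freq := by
      obtain ⟨R', -, hR'⟩ := exists_norm_poly_le (P ^ 2)
      exact Integrable.of_bound (continuous_poly (P ^ 2)).aestronglyMeasurable R' (.of_forall hR')
    have h3 := congrArg Complex.re h1
    rw [← RCLike.re_eq_complex_re, ← integral_re h2] at h3
    have h4 : ∀ x, RCLike.re ((P ^ 2).eval (ex 1 x)) =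
        (P.eval (ex 1 x)).re ^ 2 - (P.eval (ex 1 x)).im ^ 2 := fun x => by
      simp [sq]
    simp only [h4] at h3
    rw [h3]
    have h5 : (P ^ 2).coeff 0 = P.coeff 0 ^ 2 := by simp [sq, Polynomial.mul_coeff_zero]
    rw [h5]
    simp only [sq, RCLike.re_eq_complex_re, Complex.mul_re, Complex.mul_im, hP,
      Complex.re_ofNat, Complex.im_ofNat, Complex.ofReal_re, Complex.ofReal_im]
    have := Real.pi_pos
    have h6 := mul_self_nonneg (P.coeff 0).re
    nlinarith
  have hmain : ∫ x, ‖P.eval (ex 1 x)‖ ^ 2 ∂freq ≤ ∫ x, 2 ^ 2 * (P.eval (ex 1 x)).re ^ 2 ∂freq := by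
    rw [integral_sub hre him] at hsq
    have h1 : ∀ x, ‖P.eval (ex 1 x)‖ ^ 2 = (P.eval (ex 1 x)).re ^ 2 + (P.eval (ex 1 x)).im ^ 2 :=
      fun x => by rw [← Complex.normSq_eq_norm_sq, Complex.normSq_apply]; ring
    simp only [h1]
    rw [integral_add hre him, integral_const_mul]
    have h2 : 0 ≤ ∫ x, (P.eval (ex 1 x)).re ^ 2 ∂freq := integral_nonneg fun x => sq_nonneg _
    linarith
  rw [← ENNReal.pow_le_pow_left_iff two_ne_zero, mul_pow, eLpNorm_two_sq, eLpNorm_two_sq]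
  have h2 : (2 : ℝ≥0∞) ^ 2 = ENNReal.ofReal (2 ^ 2) := by
    rw [ENNReal.ofReal_pow two_pos.le]; simp
  rw [h2, ← lintegral_const_mul' _ _ ENNReal.ofReal_ne_top]
  simp only [← ENNReal.ofReal_mul (show (0 : ℝ) ≤ 2 ^ 2 by positivity), Real.norm_eq_abs, sq_abs]
  rw [← ofReal_integral_eq_lintegral_ofReal hnorm (.of_forall fun x => by positivity),
    ← ofReal_integral_eq_lintegral_ofReal (hre.const_mul _) (.of_forall fun x => by positivity)]
  exact ENNReal.ofReal_le_ofReal hmain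

lemma exists_poly_re_near_L2 {u : ℝ → ℝ} (hu : MemLp u 2 freq) (h0 : 0 ≤ u) {ε : ℝ≥0∞}
    (hε : ε ≠ 0) :
    ∃ P : Polynomial ℂ, (P.coeff 0).im = 0 ∧ (∀ x, -(1 / 2) ≤ (P.eval (ex 1 x)).re) ∧
      eLpNorm (fun x => (P.eval (ex 1 x)).re - u x) 2 freq ≤ ε := by
  have hε2 : ε / 2 ≠ 0 := by simpa using hε
  -- approximation in `L²` on the circle by a continuous function
  obtain ⟨v, hv⟩ : ∃ v : C(AddCircle (2 * Real.pi), ℝ),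
      eLpNorm (fun x : ℝ => v x - u x) 2 freq ≤ ε / 2 := by
    have hu' : MemLp (fun x => (u x : ℂ)) 2 freq := hu.ofReal
    rw [freq_eq] at hu'
    obtain ⟨w, hw, -⟩ := hu'.memLp_liftIoc.exists_boundedContinuous_eLpNorm_sub_le
      (by simp) hε2
    refine ⟨⟨fun t => (w t).re, by fun_prop⟩, le_trans ?_ hw⟩
    have hmp := measurePreserving_coe
    rw [← eLpNorm_comp_measurePreserving (hu'.memLp_liftIoc.1.sub
      w.continuous.aestronglyMeasurable) hmp]
    refine eLpNorm_mono_ae ?_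
    rw [freq_eq]
    refine (ae_restrict_iff' measurableSet_Ioc).2 (.of_forall fun x hx => ?_)
    simp only [Function.comp, Pi.sub_apply, ContinuousMap.coe_mk]
    rw [AddCircle.liftIoc_coe_apply hx, norm_sub_rev, Real.norm_eq_abs]
    refine le_trans (le_of_eq ?_) (Complex.abs_re_le_norm _)
    simp
  obtain ⟨δ, hδ0, hδ⟩ : ∃ δ : ℝ, 0 < δ ∧
      freq Set.univ ^ (2 : ℝ≥0∞).toReal⁻¹ * ENNReal.ofReal δ ≤ ε / 2 := by
    obtain ⟨δ, hδ0, hδ⟩ := ENNReal.exists_nnreal_pos_mul_lt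
      (a := freq Set.univ ^ (2 : ℝ≥0∞).toReal⁻¹) (by finiteness) hε2
    exact ⟨δ, hδ0, by rw [ENNReal.ofReal_coe_nnreal, mul_comm]; exact hδ.le⟩
  -- truncation at `0` keeps the approximation, since `u ≥ 0`
  obtain ⟨P, hP0, hP⟩ := exists_poly_re_near (v ⊔ 0) (lt_min hδ0 one_half_pos)
  refine ⟨P, hP0, fun x => ?_, ?_⟩
  · have h1 := (abs_lt.1 (hP x)).1
    have h2 : (0 : ℝ) ≤ (v ⊔ 0) x := by simp
    linarith [min_le_right δ (1 / 2)]
  · have hvc : Continuous fun x : ℝ => (v ⊔ 0) (x : AddCircle (2 * Real.pi)) :=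
      (v ⊔ 0).continuous.comp (AddCircle.continuous_mk' _)
    have e1 : (fun x => (P.eval (ex 1 x)).re - u x) =
        (fun x : ℝ => (P.eval (ex 1 x)).re - (v ⊔ 0) x) + fun x : ℝ => (v ⊔ 0) x - u x := by
      ext x; simp
    rw [e1]
    refine (eLpNorm_add_le ?_ ?_ (by norm_num)).trans ?_
    · exact ((Complex.continuous_re.comp (continuous_poly P)).sub hvc).aestronglyMeasurable
    · exact hvc.aestronglyMeasurable.sub hu.1
    rw [← ENNReal.add_halves ε]
    refine add_le_add (le_trans (eLpNorm_le_of_ae_bound (C := δ) (.of_forall fun x => ?_)) hδ)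
      (le_trans (eLpNorm_mono fun x => ?_) hv)
    · exact (hP x).le.trans (min_le_left _ _)
    · have h3 := abs_max_sub_max_le_abs (v x) (u x) 0
      rw [max_eq_left (show (0 : ℝ) ≤ u x from h0 x)] at h3
      simpa using h3

/-- A nonnegative square integrable function is the real part of a limit `V` of analytic
polynomials. The bound from below on their real parts makes `1 + δ P` invertible for `δ ≤ 1`. -/
lemma exists_poly_tendsto_ae {u : ℝ → ℝ} (hu : MemLp u 2 freq) (h0 : 0 ≤ u) :
    ∃ (P : ℕ → Polynomial ℂ) (V : ℝ → ℂ), (∀ n x, -(1 / 2) ≤ ((P n).eval (ex 1 x)).re) ∧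
      AEStronglyMeasurable V freq ∧ (∀ᵐ x ∂freq, (V x).re = u x) ∧
      ∀ᵐ x ∂freq, Tendsto (fun n => (P n).eval (ex 1 x)) atTop (𝓝 (V x)) := by
  have hpos : ∀ n : ℕ, (2⁻¹ : ℝ≥0∞) ^ n ≠ 0 := fun n => by simp
  choose P hP0 hP hPu using fun n : ℕ => exists_poly_re_near_L2 hu h0 (hpos n)
  have hmeas : ∀ n, AEStronglyMeasurable (fun x => (P n).eval (ex 1 x)) freq :=
    fun n => (continuous_poly _).aestronglyMeasurable
  have hmre : ∀ n, AEStronglyMeasurable (fun x => ((P n).eval (ex 1 x)).re) freq :=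
    fun n => (Complex.continuous_re.comp (continuous_poly _)).aestronglyMeasurable
  have hcau : ∀ᵐ x ∂freq, ∃ l, Tendsto (fun n => (P n).eval (ex 1 x)) atTop (𝓝 l) := by
    refine Lp.ae_tendsto_of_cauchy_eLpNorm (p := 2) (B := fun n => 5 * 2⁻¹ ^ n) hmeas (by norm_num)
      ?_ fun N n m hn hm => ?_
    · rw [ENNReal.tsum_mul_left, ENNReal.tsum_geometric]
      simp [ENNReal.mul_eq_top]
    · have h1 := eLpNorm_poly_le (P n - P m) (by simp [hP0])
      have h2 : eLpNorm (fun x => ((P n - P m).eval (ex 1 x)).re) 2 freq ≤ 2⁻¹ ^ N + 2⁻¹ ^ N := by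
        have e1 : (fun x => ((P n - P m).eval (ex 1 x)).re) =
            (fun x => ((P n).eval (ex 1 x)).re - u x) -
            (fun x => ((P m).eval (ex 1 x)).re - u x) := by
          ext x; simp
        rw [e1]
        refine (eLpNorm_sub_le ((hmre n).sub hu.1) ((hmre m).sub hu.1) (by norm_num)).trans ?_
        refine add_le_add ((hPu n).trans ?_) ((hPu m).trans ?_) <;>
        exact pow_le_pow_right_of_le_one' (by simp) ‹_›
      have e2 : (fun x => (P n).eval (ex 1 x)) - (fun x => (P m).eval (ex 1 x)) =
          fun x => (P n - P m).eval (ex 1 x) := by ext x; simp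
      rw [e2]
      refine (h1.trans (mul_le_mul_right h2 _)).trans_lt ?_
      rw [← two_mul, ← mul_assoc]
      refine ENNReal.mul_lt_mul_left (hpos N) (by finiteness) (by norm_num)
  obtain ⟨V, hV, hlim⟩ := exists_stronglyMeasurable_limit_of_tendsto_ae hmeas hcau
  obtain ⟨ns, hns, hre⟩ := exists_subseq_tendsto_ae (p := 2) two_ne_zero hmre hu.1
    (tendsto_of_tendsto_of_tendsto_of_le_of_le tendsto_const_nhds
      (ENNReal.tendsto_pow_atTop_nhds_zero_of_lt_one (by norm_num)) (fun _ => zero_le) hPu)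
  refine ⟨P, V, hP, hV.aestronglyMeasurable, ?_, hlim⟩
  filter_upwards [hlim, hre] with x h1 h2
  exact tendsto_nhds_unique
    ((Complex.continuous_re.tendsto _).comp (h1.comp hns.tendsto_atTop)) h2

/-- If a scalar product of two vectors with entries in `H¹` is integrable, then it is in `H¹`.
The individual products need not be integrable. With `u² = ∑ (|h_i| + |w_i|)` and `V` an analytic
function with real part `u`, the multipliers `(1 + V/n)⁻¹` are bounded by `1` and tend to `1`, and
their squares make all the `h_i` and `w_i` bounded. -/
lemma H1.sum_mul {ι : Type*} [Fintype ι] {h w : ι → ℝ → ℂ} (hh : ∀ i, H1 (h i))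
    (hw : ∀ i, H1 (w i)) (hint : Integrable (fun x => ∑ i, h i x * w i x) freq) :
    H1 (fun x => ∑ i, h i x * w i x) := by
  set S : ℝ → ℝ := fun x => ∑ i, (‖h i x‖ + ‖w i x‖) with hS
  have hS0 : ∀ x, 0 ≤ S x := fun x => Finset.sum_nonneg fun i _ => by positivity
  have hSint : Integrable S freq :=
    integrable_finsetSum _ fun i _ => (hh i).1.norm.add (hw i).1.norm
  have hu : MemLp (fun x => √(S x)) 2 freq := by
    rw [memLp_two_iff_integrable_sq hSint.1.aemeasurable.sqrt.aestronglyMeasurable]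
    simpa only [Real.sq_sqrt (hS0 _)] using hSint
  obtain ⟨P, V, hP, hVm, hVu, hlim⟩ := exists_poly_tendsto_ae hu fun x => Real.sqrt_nonneg _
  set q : ℕ → ℝ → ℂ := fun n x => (1 + ((n + 1 : ℝ)⁻¹ : ℝ) * V x)⁻¹ with hq
  have hn0 : ∀ n : ℕ, (0 : ℝ) < (n + 1 : ℝ)⁻¹ := fun n => by positivity
  have hn1 : ∀ n : ℕ, (n + 1 : ℝ)⁻¹ ≤ 1 := fun n => inv_le_one_of_one_le₀ (by simp)
  have hqmul : ∀ n, MulH1 (q n) := by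
    intro n
    have hev : ∀ m x, (1 + Polynomial.C (((n + 1 : ℝ)⁻¹ : ℝ) : ℂ) * P m).eval (ex 1 x) =
        1 + ((n + 1 : ℝ)⁻¹ : ℝ) * (P m).eval (ex 1 x) := fun m x => by
      simp
    have hre : ∀ m x, 1 / 2 ≤ (1 + (((n + 1 : ℝ)⁻¹ : ℝ) : ℂ) * (P m).eval (ex 1 x)).re := by
      intro m x
      rw [Complex.add_re, Complex.re_ofReal_mul, Complex.one_re]
      nlinarith [hP m x, hn0 n, hn1 n]
    have hmul : ∀ m, MulH1 (fun x => (1 + (((n + 1 : ℝ)⁻¹ : ℝ) : ℂ) * (P m).eval (ex 1 x))⁻¹) := by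
      intro m
      have := MulH1.inv_poly (1 + Polynomial.C (((n + 1 : ℝ)⁻¹ : ℝ) : ℂ) * P m) fun x => by
        rw [hev]; exact hre m x
      simpa only [hev] using this
    refine MulH1.of_tendsto (M := 2) hmul (fun m => .of_forall fun x => ?_) ?_
    · rw [norm_inv]
      refine inv_le_of_inv_le₀ two_pos ?_
      refine le_trans ?_ (Complex.re_le_norm _)
      simpa using hre m x
    · filter_upwards [hlim, hVu] with x hx hux
      refine Tendsto.inv₀ ((hx.const_mul _).const_add _) ?_
      intro h0
      have := congrArg Complex.re h0
      rw [Complex.add_re, Complex.re_ofReal_mul, Complex.one_re, hux] at this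
      have := mul_nonneg (hn0 n).le (Real.sqrt_nonneg (S x))
      simp at *
      linarith
  have hre : ∀ n : ℕ, ∀ᵐ x ∂freq,
      1 + (n + 1 : ℝ)⁻¹ * √(S x) ≤ ‖1 + (((n + 1 : ℝ)⁻¹ : ℝ) : ℂ) * V x‖ := by
    intro n
    filter_upwards [hVu] with x hx
    refine le_trans (le_of_eq ?_) (Complex.re_le_norm _)
    rw [Complex.add_re, Complex.re_ofReal_mul, Complex.one_re, hx]
  have hq1 : ∀ n, ∀ᵐ x ∂freq, ‖q n x‖ ≤ 1 := by
    intro n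
    filter_upwards [hre n] with x hx
    rw [norm_inv]
    refine inv_le_one_of_one_le₀ (le_trans ?_ hx)
    have := mul_nonneg (hn0 n).le (Real.sqrt_nonneg (S x))
    linarith
  have hqS : ∀ n, ∀ᵐ x ∂freq, ‖q n x‖ ^ 2 * S x ≤ (n + 1 : ℝ) ^ 2 := by
    intro n
    filter_upwards [hre n] with x hx
    have h1 : ‖q n x‖ * √(S x) ≤ n + 1 := by
      rw [norm_inv, inv_mul_le_iff₀ (lt_of_lt_of_le (add_pos_of_pos_of_nonneg one_pos
        (mul_nonneg (hn0 n).le (Real.sqrt_nonneg _))) hx), mul_comm,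
        ← inv_mul_le_iff₀ (by positivity)]
      linarith
    calc ‖q n x‖ ^ 2 * S x = (‖q n x‖ * √(S x)) ^ 2 := by rw [mul_pow, Real.sq_sqrt (hS0 x)]
      _ ≤ _ := by gcongr
  have hbdd : ∀ n, ∀ u : ℝ → ℂ, H1 u → (∀ x, ‖u x‖ ≤ S x) →
      H1 (fun x => q n x * q n x * u x) ∧ MemLp (fun x => q n x * q n x * u x) 2 freq := by
    intro n u hu huS
    have h1 := ((hqmul n).mul (hqmul n)).2 u hu
    refine ⟨h1, MemLp.of_bound h1.1.1 ((n + 1 : ℝ) ^ 2) ?_⟩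
    filter_upwards [hqS n] with x hx
    refine le_trans ?_ hx
    rw [norm_mul, norm_mul, ← sq]
    gcongr
    exact huS x
  have hle : ∀ i x, ‖h i x‖ + ‖w i x‖ ≤ S x := fun i x =>
    Finset.single_le_sum (f := fun i => ‖h i x‖ + ‖w i x‖) (fun i _ => by positivity)
      (Finset.mem_univ i)
  have hprod : ∀ n, H1 (fun x => (q n x * q n x) * (q n x * q n x) * ∑ i, h i x * w i x) := by
    intro n
    have : (fun x => (q n x * q n x) * (q n x * q n x) * ∑ i, h i x * w i x) =
        fun x => ∑ i, (q n x * q n x * h i x) * (q n x * q n x * w i x) := by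
      ext x
      rw [Finset.mul_sum]
      exact Finset.sum_congr rfl fun i _ => by ring
    rw [this]
    refine H1.sum fun i _ => ?_
    have h1 := hbdd n (h i) (hh i) fun x => by linarith [hle i x, norm_nonneg (w i x)]
    have h2 := hbdd n (w i) (hw i) fun x => by linarith [hle i x, norm_nonneg (h i x)]
    exact h1.1.mul_of_memLp h2.1 h1.2 h2.2
  refine H1.of_tendsto hprod hint.norm (fun n => ?_) (.of_forall fun x => ?_)
  · filter_upwards [hq1 n] with x hx
    rw [norm_mul, norm_mul, norm_mul]
    have := mul_le_one₀ hx (norm_nonneg _) hx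
    exact mul_le_of_le_one_left (norm_nonneg _) (mul_le_one₀ this (by positivity) this)
  · have hq' : Tendsto (fun n => q n x) atTop (𝓝 1) := by
      have h1 : Tendsto (fun n : ℕ => (((n + 1 : ℝ)⁻¹ : ℝ) : ℂ)) atTop (𝓝 0) := by
        have := tendsto_one_div_add_atTop_nhds_zero_nat (𝕜 := ℝ)
        simp only [one_div] at this
        exact_mod_cast (Complex.continuous_ofReal.tendsto 0).comp this
      have h2 := ((h1.mul_const (V x)).const_add 1).inv₀ (by simp)
      rw [zero_mul, add_zero, inv_one] at h2
      exact h2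
    simpa using ((hq'.mul hq').mul (hq'.mul hq')).mul_const (∑ i, h i x * w i x)

/-! ### Square roots of density matrices -/

open scoped MatrixOrder Matrix.Norms.L2Operator in
lemma continuousOn_matrix_sqrt (T : ℕ) :
    ContinuousOn (CFC.sqrt : Matrix (Fin T) (Fin T) ℂ → Matrix (Fin T) (Fin T) ℂ)
      {F | F.PosSemidef} := by
  have := CFC.continuousOn_sqrt (A := Matrix (Fin T) (Fin T) ℂ)
  simpa only [Matrix.nonneg_iff_posSemidef] using this

open scoped MatrixOrder Matrix.Norms.L2Operator in
lemma exists_measurable_sqrt (T : ℕ) :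
    ∃ S : Matrix (Fin T) (Fin T) ℂ → Matrix (Fin T) (Fin T) ℂ,
      (∀ F, F.PosSemidef → (S F).conjTranspose = S F ∧ S F * S F = F) ∧
      ∀ f : ℝ → Matrix (Fin T) (Fin T) ℂ, (∀ i j, AEStronglyMeasurable (fun x => f x i j) freq) →
        (∀ᵐ x ∂freq, (f x).PosSemidef) →
        ∀ i j, AEStronglyMeasurable (fun x => S (f x) i j) freq := by
  classical
  refine ⟨CFC.sqrt, fun F hF => ?_, fun f hf hpsd i j => ?_⟩
  · have h0 : 0 ≤ F := Matrix.nonneg_iff_posSemidef.2 hF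
    exact ⟨(Matrix.nonneg_iff_posSemidef.1 (CFC.sqrt_nonneg F)).1, CFC.sqrt_mul_sqrt_self F h0⟩
  · let _ : MeasurableSpace (Matrix (Fin T) (Fin T) ℂ) := borel _
    have : BorelSpace (Matrix (Fin T) (Fin T) ℂ) := ⟨rfl⟩
    have hclosed : IsClosed {F : Matrix (Fin T) (Fin T) ℂ | F.PosSemidef} := by
      have := isClosed_Ici (a := (0 : Matrix (Fin T) (Fin T) ℂ))
      convert this using 1
      ext F
      exact Matrix.nonneg_iff_posSemidef.symm
    have hf' : AEStronglyMeasurable f freq := by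
      choose g hg hfg using hf
      refine ⟨fun x i j => g i j x, ?_, ?_⟩
      · have hm : Measurable fun x i j => g i j x :=
          measurable_pi_iff.2 fun i => measurable_pi_iff.2 fun j => (hg i j).measurable
        exact hm.stronglyMeasurable
      · have := ae_all_iff.2 fun i => ae_all_iff.2 fun j => hfg i j
        filter_upwards [this] with x hx
        ext i j
        exact hx i j
    have hm := (continuousOn_matrix_sqrt T).measurable_piecewise
      (continuousOn_const (c := (0 : Matrix (Fin T) (Fin T) ℂ))) hclosed.measurableSet
    have h1 := hm.comp_aemeasurable hf'.aemeasurable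
    have hij : Continuous fun F : Matrix (Fin T) (Fin T) ℂ => F i j :=
      (continuous_apply j).comp (continuous_apply i)
    refine (hij.measurable.comp_aemeasurable h1).aestronglyMeasurable.congr ?_
    filter_upwards [hpsd] with x hx
    simp only [Function.comp]
    rw [Set.piecewise_eq_of_mem]
    exact hx

/-- A measurable choice of the square root of a nonnegative definite matrix, transposed so that
`vᵀ F v̄ = ‖root F v‖²`. -/
def root {T : ℕ} (F : Matrix (Fin T) (Fin T) ℂ) : Matrix (Fin T) (Fin T) ℂ :=
  ((exists_measurable_sqrt T).choose F).transpose

section Root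

variable {T : ℕ} {F : Matrix (Fin T) (Fin T) ℂ}

open Matrix

lemma root_conjTranspose (hF : F.PosSemidef) : (root F)ᴴ = root F := by
  have h := ((exists_measurable_sqrt T).choose_spec.1 F hF).1
  unfold root
  conv_rhs => rw [← h]
  rfl

lemma root_mul_root (hF : F.PosSemidef) : root F * root F = Fᵀ := by
  have h := ((exists_measurable_sqrt T).choose_spec.1 F hF).2
  unfold root
  rw [← transpose_mul, h]

lemma root_mulVec_root (hF : F.PosSemidef) (v : Fin T → ℂ) :
    root F *ᵥ (root F *ᵥ v) = v ᵥ* F := by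
  rw [mulVec_mulVec, root_mul_root hF, mulVec_transpose]

lemma inner_root (hF : F.PosSemidef) (c : Fin T → ℂ) (y : EuclideanSpace ℂ (Fin T)) :
    inner ℂ (WithLp.toLp 2 (root F *ᵥ c)) y = (root F *ᵥ y.ofLp) ⬝ᵥ star c := by
  rw [EuclideanSpace.inner_eq_star_dotProduct]
  simp only
  rw [star_mulVec, root_conjTranspose hF, dotProduct_comm, ← dotProduct_mulVec, dotProduct_comm]

lemma inner_root_root (hF : F.PosSemidef) (b c : Fin T → ℂ) :
    inner ℂ (WithLp.toLp 2 (root F *ᵥ c)) (WithLp.toLp 2 (root F *ᵥ b)) =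
      (b ᵥ* F) ⬝ᵥ star c := by
  rw [inner_root hF, root_mulVec_root hF]

lemma quad_eq_re (v : Fin T → ℂ) : quad F v = ((v ᵥ* F) ⬝ᵥ star v).re := by
  rw [quad, ← Matrix.dotProduct_mulVec]
  simp only [dotProduct, mulVec, Finset.mul_sum, mul_assoc]
  rfl

lemma quad_eq_norm (hF : F.PosSemidef) (v : Fin T → ℂ) :
    quad F v = ‖WithLp.toLp 2 (root F *ᵥ v)‖ ^ 2 := by
  rw [quad_eq_re, ← inner_root_root hF, inner_self_eq_norm_sq_to_K]
  norm_cast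

lemma norm_mulVec_sq_le (R : Matrix (Fin T) (Fin T) ℂ) (v : Fin T → ℂ) :
    ‖WithLp.toLp 2 (R *ᵥ v)‖ ^ 2 ≤ (Rᴴ * R).trace.re * ‖WithLp.toLp 2 v‖ ^ 2 := by
  have htr : (Rᴴ * R).trace.re = ∑ i, ∑ j, ‖R i j‖ ^ 2 := by
    rw [Finset.sum_comm]
    simp only [trace, diag_apply, mul_apply, conjTranspose_apply, Complex.re_sum]
    refine Finset.sum_congr rfl fun j _ => Finset.sum_congr rfl fun i _ => ?_
    rw [← Complex.normSq_eq_norm_sq, Complex.normSq_apply]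
    simp
  rw [htr, EuclideanSpace.norm_sq_eq, EuclideanSpace.norm_sq_eq, Finset.sum_mul]
  refine Finset.sum_le_sum fun i _ => ?_
  calc ‖(R *ᵥ v) i‖ ^ 2 ≤ (∑ j, ‖R i j‖ * ‖v j‖) ^ 2 := by
        gcongr
        refine (norm_sum_le Finset.univ fun j => R i j * v j).trans (le_of_eq ?_)
        simp
    _ ≤ _ := Finset.sum_mul_sq_le_sq_mul_sq _ _ _

lemma norm_root_mulVec_sq_le (hF : F.PosSemidef) (v : Fin T → ℂ) :
    ‖WithLp.toLp 2 (root F *ᵥ v)‖ ^ 2 ≤ F.trace.re * ‖WithLp.toLp 2 v‖ ^ 2 := by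
  have := norm_mulVec_sq_le (root F) v
  rwa [root_conjTranspose hF, root_mul_root hF, trace_transpose] at this

lemma isUnit_det_root (hF : F.PosSemidef) (hdet : IsUnit F.det) : IsUnit (root F).det := by
  have h := congrArg det (root_mul_root hF)
  rw [det_mul, det_transpose] at h
  rw [← h] at hdet
  exact (IsUnit.mul_iff.1 hdet).1

/-- Convergence in `L₂(f)` controls pointwise convergence when `f` is invertible. -/
lemma norm_sq_le_trace_inv_mul (hF : F.PosSemidef) (hdet : IsUnit F.det) (v : Fin T → ℂ) :
    ‖WithLp.toLp 2 v‖ ^ 2 ≤ F⁻¹.trace.re * ‖WithLp.toLp 2 (root F *ᵥ v)‖ ^ 2 := by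
  have := norm_mulVec_sq_le (root F)⁻¹ (root F *ᵥ v)
  rw [mulVec_mulVec, nonsing_inv_mul _ (isUnit_det_root hF hdet), one_mulVec,
    conjTranspose_nonsing_inv, root_conjTranspose hF, ← Matrix.mul_inv_rev, root_mul_root hF,
    ← transpose_nonsing_inv, trace_transpose] at this
  exact this

lemma norm_entry_le_trace (hF : F.PosSemidef) (i j : Fin T) : ‖F i j‖ ≤ F.trace.re := by
  have h := inner_root_root hF (Pi.single i 1) (Pi.single j 1)
  have h1 : (Pi.single i (1 : ℂ) ᵥ* F) ⬝ᵥ star (Pi.single j (1 : ℂ)) = F i j := by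
    simp [Pi.star_single]
  have h0 : 0 ≤ F.trace.re := (Complex.le_def.1 hF.trace_nonneg).1
  have h2 : ∀ k, ‖WithLp.toLp 2 (root F *ᵥ Pi.single k 1)‖ ≤ √F.trace.re := fun k => by
    refine Real.le_sqrt_of_sq_le ((norm_root_mulVec_sq_le hF _).trans (le_of_eq ?_))
    simp
  rw [← h1, ← h]
  refine (norm_inner_le_norm _ _).trans ?_
  calc _ ≤ √F.trace.re * √F.trace.re :=
        mul_le_mul (h2 _) (h2 _) (norm_nonneg _) (Real.sqrt_nonneg _)
    _ = _ := Real.mul_self_sqrt h0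

end Root

lemma aestronglyMeasurable_root {T : ℕ} {f : ℝ → Matrix (Fin T) (Fin T) ℂ}
    (hf : IsSpectralDensity f) (i j : Fin T) :
    AEStronglyMeasurable (fun x => root (f x) i j) freq :=
  (exists_measurable_sqrt T).choose_spec.2 f (fun i j => (hf.1 i j).1) hf.2 j i

/-! ### The weighted spaces `L₂(f)` -/

section Weighted

variable {T : ℕ} {f : ℝ → Matrix (Fin T) (Fin T) ℂ}

open Matrix

/-- The isometric copy `f^{1/2} b` in the unweighted `L²` space of a function `b` in `L₂(f)`. -/
def wt (f : ℝ → Matrix (Fin T) (Fin T) ℂ) (b : ℝ → Fin T → ℂ) (x : ℝ) : EuclideanSpace ℂ (Fin T) :=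
  WithLp.toLp 2 (root (f x) *ᵥ b x)

lemma wt_add (b c : ℝ → Fin T → ℂ) : wt f (fun x => b x + c x) = wt f b + wt f c := by
  ext x i; simp [wt, mulVec_add]

lemma wt_sub (b c : ℝ → Fin T → ℂ) : wt f (fun x => b x - c x) = wt f b - wt f c := by
  ext x i; simp [wt, mulVec_sub]

lemma wt_smul (a : ℂ) (b : ℝ → Fin T → ℂ) : wt f (fun x => a • b x) = a • wt f b := by
  ext x i; simp [wt, mulVec_smul]

lemma aemeasurable_entry {b : ℝ → Fin T → ℂ} (hb : AEMeasurable b freq) (i : Fin T) :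
    AEStronglyMeasurable (fun x => b x i) freq :=
  ((measurable_pi_apply i).comp_aemeasurable hb).aestronglyMeasurable

lemma aestronglyMeasurable_toLp {b : ℝ → Fin T → ℂ}
    (hb : ∀ i, AEStronglyMeasurable (fun x => b x i) freq) :
    AEStronglyMeasurable (fun x => WithLp.toLp 2 (b x)) freq := by
  have h : AEMeasurable b freq := aemeasurable_pi_iff.2 fun i => (hb i).aemeasurable
  exact (PiLp.continuous_toLp 2 _).comp_aestronglyMeasurable h.aestronglyMeasurable

lemma aestronglyMeasurable_mulVec {R : ℝ → Matrix (Fin T) (Fin T) ℂ} {b : ℝ → Fin T → ℂ}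
    (hR : ∀ i j, AEStronglyMeasurable (fun x => R x i j) freq)
    (hb : ∀ i, AEStronglyMeasurable (fun x => b x i) freq) (i : Fin T) :
    AEStronglyMeasurable (fun x => (R x *ᵥ b x) i) freq := by
  simp only [mulVec, dotProduct]
  exact Finset.aestronglyMeasurable_fun_sum _ fun j _ => (hR i j).mul (hb j)

lemma aestronglyMeasurable_wt (hf : IsSpectralDensity f) {b : ℝ → Fin T → ℂ}
    (hb : AEMeasurable b freq) : AEStronglyMeasurable (wt f b) freq :=
  aestronglyMeasurable_toLp
    (aestronglyMeasurable_mulVec (aestronglyMeasurable_root hf) (aemeasurable_entry hb))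

lemma normSq_eq_eLpNorm (hf : IsSpectralDensity f) (b : ℝ → Fin T → ℂ) :
    normSq f b = ENNReal.ofReal (1 / (2 * Real.pi)) * eLpNorm (wt f b) 2 freq ^ 2 := by
  rw [normSq, eLpNorm_two_sq]
  congr 1
  refine lintegral_congr_ae ?_
  filter_upwards [hf.2] with x hx
  rw [quad_eq_norm hx]
  rfl

lemma ofReal_pi_ne_zero : ENNReal.ofReal (1 / (2 * Real.pi)) ≠ 0 := by
  have := Real.pi_pos
  simp only [ne_eq, ENNReal.ofReal_eq_zero, not_le]
  positivity

lemma mem_L2_iff (hf : IsSpectralDensity f) {b : ℝ → Fin T → ℂ} :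
    b ∈ L2 f ↔ AEMeasurable b freq ∧ MemLp (wt f b) 2 freq := by
  simp only [L2, Set.mem_ofPred_eq, normSq_eq_eLpNorm hf]
  refine and_congr_right fun hb => ?_
  rw [MemLp, ENNReal.mul_lt_top_iff]
  simp only [ENNReal.ofReal_lt_top, true_and, ofReal_pi_ne_zero, false_or, pow_eq_zero_iff,
    ne_eq, OfNat.ofNat_ne_zero, not_false_eq_true, aestronglyMeasurable_wt hf hb]
  constructor
  · rintro (h | h)
    · simpa using h
    · simp [h]
  · intro h
    exact Or.inl (ENNReal.pow_lt_top h)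

/-- The image of `b` in the unweighted space, as an element of `Lp` (zero if `b` is not in
`L₂(f)`). -/
def emb (f : ℝ → Matrix (Fin T) (Fin T) ℂ) (b : ℝ → Fin T → ℂ) :
    Lp (EuclideanSpace ℂ (Fin T)) 2 freq :=
  open Classical in if h : MemLp (wt f b) 2 freq then h.toLp else 0

lemma emb_ae (hf : IsSpectralDensity f) {b : ℝ → Fin T → ℂ} (hb : b ∈ L2 f) :
    emb f b =ᵐ[freq] wt f b := by
  have h := ((mem_L2_iff hf).1 hb).2
  rw [emb, dif_pos h]
  exact h.coeFn_toLp

lemma normSq_eq_norm_emb (hf : IsSpectralDensity f) {b : ℝ → Fin T → ℂ} (hb : b ∈ L2 f) :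
    normSq f b = ENNReal.ofReal (1 / (2 * Real.pi) * ‖emb f b‖ ^ 2) := by
  rw [normSq_eq_eLpNorm hf, ENNReal.ofReal_mul (by positivity), Lp.norm_def,
    ENNReal.ofReal_pow ENNReal.toReal_nonneg, ENNReal.ofReal_toReal (Lp.eLpNorm_ne_top _),
    eLpNorm_congr_ae (emb_ae hf hb)]

lemma L2_add (hf : IsSpectralDensity f) {b c : ℝ → Fin T → ℂ} (hb : b ∈ L2 f) (hc : c ∈ L2 f) :
    (fun x => b x + c x) ∈ L2 f := by
  rw [mem_L2_iff hf] at *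
  exact ⟨hb.1.add hc.1, by rw [wt_add]; exact hb.2.add hc.2⟩

lemma L2_sub (hf : IsSpectralDensity f) {b c : ℝ → Fin T → ℂ} (hb : b ∈ L2 f) (hc : c ∈ L2 f) :
    (fun x => b x - c x) ∈ L2 f := by
  rw [mem_L2_iff hf] at *
  exact ⟨hb.1.sub hc.1, by rw [wt_sub]; exact hb.2.sub hc.2⟩

lemma emb_add (hf : IsSpectralDensity f) {b c : ℝ → Fin T → ℂ} (hb : b ∈ L2 f) (hc : c ∈ L2 f) :
    emb f (fun x => b x + c x) = emb f b + emb f c := by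
  refine Lp.ext ?_
  filter_upwards [emb_ae hf hb, emb_ae hf hc, emb_ae hf (L2_add hf hb hc),
    Lp.coeFn_add (emb f b) (emb f c)] with x h1 h2 h3 h4
  rw [h3, h4, wt_add, Pi.add_apply, Pi.add_apply, h1, h2]

lemma emb_sub (hf : IsSpectralDensity f) {b c : ℝ → Fin T → ℂ} (hb : b ∈ L2 f) (hc : c ∈ L2 f) :
    emb f (fun x => b x - c x) = emb f b - emb f c := by
  refine Lp.ext ?_
  filter_upwards [emb_ae hf hb, emb_ae hf hc, emb_ae hf (L2_sub hf hb hc),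
    Lp.coeFn_sub (emb f b) (emb f c)] with x h1 h2 h3 h4
  rw [h3, h4, wt_sub, Pi.sub_apply, Pi.sub_apply, h1, h2]

lemma L2_smul (hf : IsSpectralDensity f) {b : ℝ → Fin T → ℂ} (a : ℂ) (hb : b ∈ L2 f) :
    (fun x => a • b x) ∈ L2 f := by
  rw [mem_L2_iff hf] at *
  exact ⟨hb.1.const_smul a, by rw [wt_smul]; exact hb.2.const_smul a⟩

lemma emb_smul (hf : IsSpectralDensity f) {b : ℝ → Fin T → ℂ} (a : ℂ) (hb : b ∈ L2 f) :
    emb f (fun x => a • b x) = a • emb f b := by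
  refine Lp.ext ?_
  filter_upwards [emb_ae hf hb, emb_ae hf (L2_smul hf a hb),
    Lp.coeFn_smul a (emb f b)] with x h1 h2 h3
  rw [h2, h3, wt_smul, Pi.smul_apply, Pi.smul_apply, h1]

lemma inner_emb (hf : IsSpectralDensity f) {b c : ℝ → Fin T → ℂ} (hb : b ∈ L2 f) (hc : c ∈ L2 f) :
    inner ℂ (emb f c) (emb f b) = ∫ x, (b x ᵥ* f x) ⬝ᵥ star (c x) ∂freq := by
  rw [L2.inner_def]
  refine integral_congr_ae ?_
  filter_upwards [emb_ae hf hb, emb_ae hf hc, hf.2] with x h1 h2 h3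
  rw [h1, h2]
  exact inner_root_root h3 _ _

lemma integrable_trace (hf : IsSpectralDensity f) : Integrable (fun x => (f x).trace.re) freq := by
  have : Integrable (fun x => (f x).trace) freq := by
    simp only [trace, diag_apply]
    exact integrable_finsetSum _ fun i _ => hf.1 i i
  exact this.re

/-- Bounded measurable functions belong to `L₂(f)`. -/
lemma mem_L2_of_bounded (hf : IsSpectralDensity f) {b : ℝ → Fin T → ℂ} (hb : AEMeasurable b freq)
    {M : ℝ} (hM : ∀ x, ‖WithLp.toLp 2 (b x)‖ ≤ M) : b ∈ L2 f := by
  refine (mem_L2_iff hf).2 ⟨hb, ?_⟩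
  have hm := aestronglyMeasurable_wt hf hb
  rw [memLp_two_iff_integrable_sq_norm hm]
  refine ((integrable_trace hf).mul_const (M ^ 2)).mono' (hm.norm.pow 2) ?_
  filter_upwards [hf.2] with x hx
  rw [Real.norm_eq_abs, abs_of_nonneg (by positivity)]
  refine (norm_root_mulVec_sq_le hx _).trans ?_
  have h0 : 0 ≤ (f x).trace.re := (Complex.le_def.1 hx.trace_nonneg).1
  have := hM x
  gcongr

/-- The vector function `e^{ikλ} δ_ν`. -/
def expv (k : ℤ) (ν : Fin T) (x : ℝ) : Fin T → ℂ := ex k x • Pi.single ν 1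

lemma continuous_expv (k : ℤ) (ν : Fin T) : Continuous (expv k ν) :=
  (continuous_ex k).smul continuous_const

lemma norm_expv (k : ℤ) (ν : Fin T) (x : ℝ) : ‖WithLp.toLp 2 (expv k ν x)‖ = 1 := by
  simp [expv, norm_smul]

lemma dotProduct_star_expv (v : Fin T → ℂ) (k : ℤ) (ν : Fin T) (x : ℝ) :
    v ⬝ᵥ star (expv k ν x) = v ν * ex (-k) x := by
  simp only [expv, star_smul, Pi.star_single, star_one, dotProduct_smul, dotProduct_single,
    mul_one, smul_eq_mul]
  rw [← conj_ex]; simp [mul_comm]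

lemma expv_mem_L2 (hf : IsSpectralDensity f) (k : ℤ) (ν : Fin T) : expv k ν ∈ L2 f :=
  mem_L2_of_bounded hf (continuous_expv k ν).aemeasurable fun x => (norm_expv k ν x).le

/-- The Fourier coefficients of `root(f) r` are the scalar products of `r` with the characters. -/
lemma fc_root_mulVec (hf : IsSpectralDensity f) (r : Lp (EuclideanSpace ℂ (Fin T)) 2 freq)
    (ν : Fin T) :
    Integrable (fun x => (root (f x) *ᵥ (r x).ofLp) ν) freq ∧
    ∀ k, fc (fun x => (root (f x) *ᵥ (r x).ofLp) ν) k = inner ℂ (emb f (expv k ν)) r := by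
  have key : ∀ k, ∀ᵐ x ∂freq, inner ℂ (emb f (expv k ν) x) (r x) =
      (root (f x) *ᵥ (r x).ofLp) ν * ex (-k) x := by
    intro k
    filter_upwards [emb_ae hf (expv_mem_L2 hf k ν), hf.2] with x h1 h2
    rw [h1]
    exact (inner_root h2 _ _).trans (dotProduct_star_expv _ _ _ _)
  refine ⟨(L2.integrable_inner (𝕜 := ℂ) (emb f (expv 0 ν)) r).congr ?_, fun k => ?_⟩
  · filter_upwards [key 0] with x hx
    simpa using hx
  · rw [L2.inner_def]
    exact (integral_congr_ae (key k)).symm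

lemma fc_vecMul (hf : IsSpectralDensity f) {b : ℝ → Fin T → ℂ} (hb : b ∈ L2 f) (ν : Fin T) :
    Integrable (fun x => (b x ᵥ* f x) ν) freq ∧
    ∀ k, fc (fun x => (b x ᵥ* f x) ν) k = inner ℂ (emb f (expv k ν)) (emb f b) := by
  have h := fc_root_mulVec hf (emb f b) ν
  have he : (fun x => (root (f x) *ᵥ (emb f b x).ofLp) ν) =ᵐ[freq] fun x => (b x ᵥ* f x) ν := by
    filter_upwards [emb_ae hf hb, hf.2] with x h1 h2
    rw [h1, wt, root_mulVec_root h2]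
  exact ⟨h.1.congr he, fun k => by rw [← fc_congr he, h.2]⟩

end Weighted

/-! ### Inverse densities -/

section Inverse

variable {T : ℕ} {f : ℝ → Matrix (Fin T) (Fin T) ℂ}

open Matrix

lemma aestronglyMeasurable_inv {R : ℝ → Matrix (Fin T) (Fin T) ℂ}
    (hR : ∀ i j, AEStronglyMeasurable (fun x => R x i j) freq) (i j : Fin T) :
    AEStronglyMeasurable (fun x => (R x)⁻¹ i j) freq := by
  have hR' : AEMeasurable (fun x i j => R x i j) freq :=
    aemeasurable_pi_iff.2 fun i => aemeasurable_pi_iff.2 fun j => (hR i j).aemeasurable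
  have hdet : Continuous fun F : Fin T → Fin T → ℂ => (Matrix.of F).det :=
    Continuous.matrix_det continuous_id
  have hadj : Continuous fun F : Fin T → Fin T → ℂ => (Matrix.of F).adjugate i j :=
    (Continuous.matrix_adjugate (A := fun F : Fin T → Fin T → ℂ => Matrix.of F)
      continuous_id).matrix_elem i j
  have h1 := hdet.measurable.comp_aemeasurable hR'
  have h2 := hadj.measurable.comp_aemeasurable hR'
  refine (h1.inv.mul h2).aestronglyMeasurable.congr (.of_forall fun x => ?_)
  simp only [Matrix.inv_def, Ring.inverse_eq_inv', Matrix.smul_apply, smul_eq_mul]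
  rfl

/-- The inverse density `f⁻¹`. -/
def invd (f : ℝ → Matrix (Fin T) (Fin T) ℂ) (x : ℝ) : Matrix (Fin T) (Fin T) ℂ := (f x)⁻¹

lemma isSpectralDensity_invd (hf : IsSpectralDensity f) (hm : IsMinimal f) :
    IsSpectralDensity (invd f) := by
  have hpsd : ∀ᵐ x ∂freq, (invd f x).PosSemidef := by
    filter_upwards [hf.2] with x hx using hx.inv
  refine ⟨fun i j => ?_, hpsd⟩
  refine hm.2.re.mono' (aestronglyMeasurable_inv (fun i j => (hf.1 i j).1) i j) ?_
  filter_upwards [hpsd] with x hx using norm_entry_le_trace hx i j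

lemma invd_invd (hm : IsMinimal f) : ∀ᵐ x ∂freq, (invd f x)⁻¹ = f x := by
  filter_upwards [hm.1] with x hx
  exact nonsing_inv_nonsing_inv _ hx

lemma isMinimal_invd (hf : IsSpectralDensity f) (hm : IsMinimal f) : IsMinimal (invd f) := by
  constructor
  · filter_upwards [hm.1] with x hx
    exact (Matrix.isUnit_nonsing_inv_det_iff).2 hx
  · have : Integrable (fun x => (f x).trace) freq := by
      simp only [trace, diag_apply]
      exact integrable_finsetSum _ fun i _ => hf.1 i i
    refine this.congr ?_
    filter_upwards [invd_invd hm] with x hx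
    rw [hx]

/-- Under the minimality condition functions in `L₂(f)` are integrable, and their Fourier
coefficients are continuous linear functionals on `L₂(f)`. -/
lemma exists_fc_functional (hf : IsSpectralDensity f) (hm : IsMinimal f) (k : ℤ) (ν : Fin T) :
    ∃ ξ : Lp (EuclideanSpace ℂ (Fin T)) 2 freq, ∀ b ∈ L2 f,
      Integrable (fun x => b x ν) freq ∧ fc (fun x => b x ν) k = inner ℂ ξ (emb f b) := by
  set ξ : ℝ → EuclideanSpace ℂ (Fin T) :=
    fun x => WithLp.toLp 2 ((root (f x))⁻¹ *ᵥ expv k ν x) with hξ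
  have hξm : AEStronglyMeasurable ξ freq := aestronglyMeasurable_toLp
    (aestronglyMeasurable_mulVec (aestronglyMeasurable_inv (aestronglyMeasurable_root hf))
      (aemeasurable_entry (continuous_expv k ν).aemeasurable))
  have hξ2 : MemLp ξ 2 freq := by
    rw [memLp_two_iff_integrable_sq_norm hξm]
    refine hm.2.re.mono' (hξm.norm.pow 2) ?_
    filter_upwards [hf.2, hm.1] with x hx hdet
    have h := norm_mulVec_sq_le (root (f x))⁻¹ (expv k ν x)
    rw [conjTranspose_nonsing_inv, root_conjTranspose hx, ← Matrix.mul_inv_rev, root_mul_root hx,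
      ← transpose_nonsing_inv, trace_transpose, norm_expv] at h
    simpa using h
  refine ⟨hξ2.toLp, fun b hb => ?_⟩
  have key : ∀ᵐ x ∂freq, inner ℂ (hξ2.toLp ξ x) (emb f b x) = b x ν * ex (-k) x := by
    filter_upwards [hf.2, hm.1, hξ2.coeFn_toLp, emb_ae hf hb] with x hx hdet h1 h2
    have hu := isUnit_det_root hx hdet
    rw [h1, h2, EuclideanSpace.inner_eq_star_dotProduct]
    simp only [hξ, wt]
    rw [star_mulVec, conjTranspose_nonsing_inv, root_conjTranspose hx, dotProduct_comm,
      ← dotProduct_mulVec, mulVec_mulVec, nonsing_inv_mul _ hu, one_mulVec, dotProduct_comm,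
      dotProduct_star_expv]
  have hint := (L2.integrable_inner (𝕜 := ℂ) (hξ2.toLp ξ) (emb f b)).congr key
  refine ⟨?_, ?_⟩
  · have := integrable_mul_ex (u := fun x => b x ν * ex (-k) x) hint k
    refine this.congr (.of_forall fun x => ?_)
    simp only
    rw [mul_assoc, mul_comm (ex (-k) x), ex_mul_ex_neg, mul_one]
  · rw [L2.inner_def]
    exact (integral_congr_ae key).symm

/-- The embedding of `L₂(f)` is onto when `f` is invertible. -/
lemma exists_emb_eq (hf : IsSpectralDensity f) (hm : IsMinimal f)
    (r : Lp (EuclideanSpace ℂ (Fin T)) 2 freq) : ∃ b ∈ L2 f, emb f b = r := by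
  set b : ℝ → Fin T → ℂ := fun x => (root (f x))⁻¹ *ᵥ (r x).ofLp with hb
  have hwt : wt f b =ᵐ[freq] r := by
    filter_upwards [hf.2, hm.1] with x hx hdet
    simp only [wt, hb]
    rw [mulVec_mulVec, mul_nonsing_inv _ (isUnit_det_root hx hdet), one_mulVec]
  have hbm : AEMeasurable b freq := by
    refine aemeasurable_pi_iff.2 fun i => (aestronglyMeasurable_mulVec
      (aestronglyMeasurable_inv (aestronglyMeasurable_root hf)) (fun j => ?_) i).aemeasurable
    exact ((EuclideanSpace.proj (𝕜 := ℂ) j).continuous.comp_aestronglyMeasurable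
      (Lp.aestronglyMeasurable r))
  have hb2 : b ∈ L2 f := (mem_L2_iff hf).2 ⟨hbm, (memLp_congr_ae hwt).2 (Lp.memLp r)⟩
  exact ⟨b, hb2, Lp.ext ((emb_ae hf hb2).trans hwt)⟩

end Inverse

/-! ### Trigonometric polynomials and the space `L₂ˢ(f)` -/

section Trig

variable {T : ℕ} {f : ℝ → Matrix (Fin T) (Fin T) ℂ}

open Matrix

lemma trigPoly_eq (p : ℤ →₀ (Fin T → ℂ)) (x : ℝ) :
    trigPoly p x = p.sum fun j v => ex j x • v := by
  ext ν
  simp only [trigPoly, Finsupp.sum, Finset.sum_apply, Pi.smul_apply, smul_eq_mul]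
  exact Finset.sum_congr rfl fun j _ => mul_comm _ _

lemma trigPoly_add (p q : ℤ →₀ (Fin T → ℂ)) (x : ℝ) :
    trigPoly (p + q) x = trigPoly p x + trigPoly q x := by
  simp only [trigPoly_eq]
  exact Finsupp.sum_add_index' (by simp) (by simp)

lemma trigPoly_smul (a : ℂ) (p : ℤ →₀ (Fin T → ℂ)) (x : ℝ) :
    trigPoly (a • p) x = a • trigPoly p x := by
  simp only [trigPoly_eq]
  rw [Finsupp.sum_smul_index' (by simp), Finsupp.smul_sum]
  simp only [smul_comm a]

lemma trigPoly_single (k : ℤ) (ν : Fin T) :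
    trigPoly (Finsupp.single k (Pi.single ν (1 : ℂ))) = expv k ν := by
  ext1 x
  rw [trigPoly_eq, Finsupp.sum_single_index (by simp)]
  rfl

lemma continuous_trigPoly (p : ℤ →₀ (Fin T → ℂ)) : Continuous (trigPoly p) := by
  have : trigPoly p = fun x => p.sum fun j v => ex j x • v := funext (trigPoly_eq p)
  rw [this]
  simp only [Finsupp.sum]
  fun_prop

lemma trigPoly_mem_L2 (hf : IsSpectralDensity f) (p : ℤ →₀ (Fin T → ℂ)) : trigPoly p ∈ L2 f := by
  refine mem_L2_of_bounded hf (continuous_trigPoly p).aemeasurable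
    (M := ∑ j ∈ p.support, ‖WithLp.toLp 2 (p j)‖) fun x => ?_
  rw [trigPoly_eq, Finsupp.sum, WithLp.toLp_sum]
  refine (norm_sum_le _ _).trans (Finset.sum_le_sum fun j _ => ?_)
  rw [WithLp.toLp_smul, norm_smul, norm_ex, one_mul]

lemma fc_trigPoly (p : ℤ →₀ (Fin T → ℂ)) (ν : Fin T) (k : ℤ) :
    fc (fun x => trigPoly p x ν) k = 2 * Real.pi * p k ν := by
  have hint : ∀ j : ℤ, Integrable (ex j) freq := fun j => by
    simpa using integrable_mul_ex (integrable_const (1 : ℂ)) j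
  have : (fun x => trigPoly p x ν) = fun x => ∑ j ∈ p.support, p j ν * ex j x := rfl
  rw [this, fc_sum _ fun j _ => (hint j).const_mul _]
  simp only [fc_const_mul, fc_ex, mul_ite, mul_zero]
  rw [Finset.sum_ite_eq]
  split_ifs with h
  · ring
  · rw [Finsupp.notMem_support_iff.1 h]; simp

/-- Trigonometric polynomials as elements of the unweighted copy of `L₂(f)`. -/
def polyEmb (hf : IsSpectralDensity f) :
    (ℤ →₀ (Fin T → ℂ)) →ₗ[ℂ] Lp (EuclideanSpace ℂ (Fin T)) 2 freq where
  toFun p := emb f (trigPoly p)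
  map_add' p q := by
    rw [← emb_add hf (trigPoly_mem_L2 hf p) (trigPoly_mem_L2 hf q)]
    congr 1; ext1 x; exact trigPoly_add p q x
  map_smul' a p := by
    rw [RingHom.id_apply, ← emb_smul hf a (trigPoly_mem_L2 hf p)]
    congr 1; ext1 x; exact trigPoly_smul a p x

/-- The image of the trigonometric polynomials with frequencies in `O`. -/
def polySpan (hf : IsSpectralDensity f) (O : Set ℤ) :
    Submodule ℂ (Lp (EuclideanSpace ℂ (Fin T)) 2 freq) :=
  (Finsupp.supported (Fin T → ℂ) ℂ O).map (polyEmb hf)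

lemma expv_mem_polySpan (hf : IsSpectralDensity f) {O : Set ℤ} {k : ℤ} (hk : k ∈ O) (ν : Fin T) :
    emb f (expv k ν) ∈ polySpan hf O := by
  refine ⟨Finsupp.single k (Pi.single ν (1 : ℂ)), ?_, ?_⟩
  · exact Finsupp.single_mem_supported ℂ _ hk
  · simp only [polyEmb, LinearMap.coe_mk, AddHom.coe_mk, trigPoly_single]

lemma polyEmb_eq_sum (hf : IsSpectralDensity f) (p : ℤ →₀ (Fin T → ℂ)) :
    polyEmb hf p = ∑ k ∈ p.support, ∑ ν, p k ν • emb f (expv k ν) := by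
  have hp : p = ∑ k ∈ p.support, ∑ ν, p k ν • Finsupp.single k (Pi.single ν (1 : ℂ)) := by
    conv_lhs => rw [← Finsupp.sum_single p, Finsupp.sum]
    refine Finset.sum_congr rfl fun k _ => ?_
    conv_lhs => rw [pi_eq_sum_univ' (p k), Finsupp.single_finsetSum]
    refine Finset.sum_congr rfl fun ν _ => ?_
    rw [Finsupp.smul_single]
  conv_lhs => rw [hp]
  simp only [map_sum, map_smul]
  simp only [polyEmb, LinearMap.coe_mk, AddHom.coe_mk, trigPoly_single]

lemma polySpan_eq_span (hf : IsSpectralDensity f) (O : Set ℤ) :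
    polySpan hf O = Submodule.span ℂ {v | ∃ k ∈ O, ∃ ν, v = emb f (expv k ν)} := by
  refine le_antisymm ?_ (Submodule.span_le.2 ?_)
  · rintro _ ⟨p, hp, rfl⟩
    rw [polyEmb_eq_sum]
    refine Submodule.sum_mem _ fun k hk => Submodule.sum_mem _ fun ν _ => Submodule.smul_mem _ _ ?_
    exact Submodule.subset_span ⟨k, hp hk, ν, rfl⟩
  · rintro _ ⟨k, hk, ν, rfl⟩
    exact expv_mem_polySpan hf hk ν

lemma mem_L2s_iff (hf : IsSpectralDensity f) {s : ℕ} {N K : ℕ → ℕ} {h : ℝ → Fin T → ℂ} :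
    h ∈ L2s s N K f ↔ h ∈ L2 f ∧
      emb f h ∈ (polySpan hf (observed s N K)).topologicalClosure := by
  refine and_congr_right fun hh => ?_
  have hdist : ∀ p, normSq f (fun x => h x - trigPoly p x) =
      ENNReal.ofReal (1 / (2 * Real.pi) * ‖emb f h - polyEmb hf p‖ ^ 2) := fun p => by
    rw [normSq_eq_norm_emb hf (L2_sub hf hh (trigPoly_mem_L2 hf p)),
      emb_sub hf hh (trigPoly_mem_L2 hf p)]
    rfl
  have hpi : (0 : ℝ) < 1 / (2 * Real.pi) := by positivity
  rw [← SetLike.mem_coe, Submodule.topologicalClosure_coe, Metric.mem_closure_iff]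
  simp only [hdist]
  constructor
  · intro H ε hε
    obtain ⟨p, hp, hpε⟩ := H (ENNReal.ofReal (1 / (2 * Real.pi) * ε ^ 2))
      (ENNReal.ofReal_pos.2 (by positivity))
    refine ⟨polyEmb hf p, ⟨p, hp, rfl⟩, ?_⟩
    rw [ENNReal.ofReal_lt_ofReal_iff (by positivity), mul_lt_mul_iff_right₀ hpi] at hpε
    rw [dist_eq_norm]
    exact lt_of_pow_lt_pow_left₀ 2 hε.le hpε
  · intro H ε hε
    obtain ⟨δ, hδ0, hδ⟩ := ENNReal.lt_iff_exists_real_btwn.1 hε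
    have hδ0' : 0 < δ := ENNReal.ofReal_pos.1 hδ.1
    obtain ⟨_, ⟨p, hp, rfl⟩, hd⟩ := H (√(δ * (2 * Real.pi))) (Real.sqrt_pos.2 (by positivity))
    refine ⟨p, hp, lt_of_lt_of_le ?_ hδ.2.le⟩
    rw [ENNReal.ofReal_lt_ofReal_iff hδ0']
    rw [dist_eq_norm] at hd
    have h1 : ‖emb f h - polyEmb hf p‖ ^ 2 < δ * (2 * Real.pi) := by
      rw [← Real.sq_sqrt (show 0 ≤ δ * (2 * Real.pi) by positivity)]
      gcongr
    rw [one_div, inv_mul_lt_iff₀ (by positivity)]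
    linarith

lemma missing_finite (s : ℕ) (N K : ℕ → ℕ) : (missing s N K).Finite := by
  have : missing s N K ⊆ ⋃ l ∈ Finset.Icc 1 s, Set.Icc (-(M N K l : ℤ)) 0 := by
    rintro j ⟨l, hl, h1, h2⟩
    simp only [Set.mem_iUnion]
    exact ⟨l, hl, h1, by omega⟩
  exact ((Finset.Icc 1 s).finite_toSet.biUnion fun l _ => Set.finite_Icc _ _).subset this

lemma not_mem_Gam_iff {s : ℕ} {N K : ℕ → ℕ} {k : ℤ} : k ∉ Gam s N K ↔ k ∈ observed s N K := by
  simp only [Gam, observed, Set.mem_union, Set.mem_ofPred_eq, Set.mem_sdiff, not_or, not_le]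
  exact and_comm

/-- If the Fourier coefficients of the components of `h` vanish on `Γ` and those of `W` vanish off
`Γ`, and `∑ W_ν conj h_ν` is integrable, then it has mean zero. A trigonometric polynomial with
frequencies in the finite set of missing times reduces this to the case without gaps. -/
lemma integral_dotProduct_star_eq_zero {s : ℕ} {N K : ℕ → ℕ} {h W : ℝ → Fin T → ℂ}
    (hh : ∀ ν, Integrable (fun x => h x ν) freq) (hW : ∀ ν, Integrable (fun x => W x ν) freq)
    (hh0 : ∀ ν, ∀ k ∈ Gam s N K, fc (fun x => h x ν) k = 0)
    (hW0 : ∀ ν, ∀ k ∈ observed s N K, fc (fun x => W x ν) k = 0)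
    (hint : Integrable (fun x => W x ⬝ᵥ star (h x)) freq) :
    ∫ x, W x ⬝ᵥ star (h x) ∂freq = 0 := by
  set q : ℤ →₀ (Fin T → ℂ) := Finsupp.onFinset (missing_finite s N K).toFinset
    (fun k ν => open Classical in
      if k ∈ missing s N K then (1 / (2 * Real.pi) : ℂ) * fc (fun x => W x ν) k else 0) (by
      intro k hk
      rw [Set.Finite.mem_toFinset]
      by_contra h
      exact hk (by ext ν; simp [h])) with hq
  have hqk : ∀ k ν, 2 * Real.pi * q k ν =
      open Classical in if k ∈ missing s N K then fc (fun x => W x ν) k else 0 := by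
    intro k ν
    have hpi : (Real.pi : ℂ) ≠ 0 := by exact_mod_cast Real.pi_ne_zero
    simp only [hq, Finsupp.onFinset_apply]
    split_ifs
    · field_simp
    · simp
  have hqi : ∀ ν, Integrable (fun x => trigPoly q x ν) freq := fun ν => by
    have hc : Continuous fun x => trigPoly q x ν :=
      (continuous_apply ν).comp (continuous_trigPoly q)
    rw [freq]
    exact hc.integrableOn_Ioc
  -- the part of `W` with nonnegative frequencies
  have hplus : ∀ ν, H1 (fun x => W x ν - trigPoly q x ν) := by
    refine fun ν => ⟨(hW ν).sub (hqi ν), fun k hk => ?_⟩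
    rw [fc_sub (hW ν) (hqi ν), fc_trigPoly, hqk]
    split_ifs with hm
    · simp
    · rw [hW0 ν k ⟨hk, hm⟩, sub_zero]
  -- the shift by one frequency turns the mean into the coefficient of index `-1`
  have hbar : ∀ ν, H1 (fun x => conj (h x ν) * ex (-1) x) := by
    refine fun ν => ⟨integrable_mul_ex
      (Complex.conjCLE.toContinuousLinearMap.integrable_comp (hh ν)) _, fun k hk => ?_⟩
    rw [fc_mul_ex (fun x => conj (h x ν)), fc_conj (fun x => h x ν),
      hh0 ν _ (Or.inr (by simp only [Set.mem_ofPred_eq]; omega)), map_zero]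
  have hqh : ∀ ν, Integrable (fun x => trigPoly q x ν * conj (h x ν)) freq ∧
      ∫ x, trigPoly q x ν * conj (h x ν) ∂freq = 0 := by
    intro ν
    have e1 : (fun x => trigPoly q x ν * conj (h x ν)) =
        fun x => ∑ j ∈ q.support, q j ν * (conj (h x ν) * ex j x) := by
      ext x
      simp only [trigPoly, Finset.sum_mul]
      refine Finset.sum_congr rfl fun j _ => ?_
      rw [ex]; ring
    have hi : ∀ j : ℤ, Integrable (fun x => conj (h x ν) * ex j x) freq := fun j =>
      integrable_mul_ex (Complex.conjCLE.toContinuousLinearMap.integrable_comp (hh ν)) _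
    rw [e1]
    refine ⟨integrable_finsetSum _ fun j _ => (hi j).const_mul _, ?_⟩
    rw [integral_finsetSum _ fun j _ => (hi j).const_mul _]
    refine Finset.sum_eq_zero fun j hj => ?_
    rw [integral_const_mul]
    by_cases hjm : j ∈ missing s N K
    · have h1 := fc_conj (fun x => h x ν) (-j)
      rw [fc, neg_neg, hh0 ν j (Or.inl hjm), map_zero] at h1
      rw [h1, mul_zero]
    · have h1 := hqk j ν
      rw [if_neg hjm] at h1
      have hpi : (2 * Real.pi : ℂ) ≠ 0 := by exact_mod_cast (by positivity : 2 * Real.pi ≠ 0)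
      rw [(mul_eq_zero.1 h1).resolve_left hpi, zero_mul]
  have hqsum : Integrable (fun x => ∑ ν, trigPoly q x ν * conj (h x ν)) freq :=
    integrable_finsetSum _ fun ν _ => (hqh ν).1
  have hprod : Integrable
      (fun x => ∑ ν, (conj (h x ν) * ex (-1) x) * (W x ν - trigPoly q x ν)) freq := by
    refine (integrable_mul_ex (hint.sub hqsum) (-1)).congr (.of_forall fun x => ?_)
    simp only [dotProduct, Pi.star_apply, Pi.sub_apply, ← Finset.sum_sub_distrib, Finset.sum_mul]
    refine Finset.sum_congr rfl fun ν _ => ?_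
    rw [← starRingEnd_apply]; ring
  have key := (H1.sum_mul hbar hplus hprod).2 (-1) (by norm_num)
  have e2 : (fun x => W x ⬝ᵥ star (h x)) = fun x =>
      (∑ ν, (conj (h x ν) * ex (-1) x) * (W x ν - trigPoly q x ν)) * ex (- -1) x +
        ∑ ν, trigPoly q x ν * conj (h x ν) := by
    ext x
    have hex := ex_mul_ex_neg (-1) x
    simp only [dotProduct, Pi.star_apply, Finset.sum_mul, ← Finset.sum_add_distrib]
    refine Finset.sum_congr rfl fun ν _ => ?_
    rw [← starRingEnd_apply]
    linear_combination (-(W x ν - trigPoly q x ν) * conj (h x ν)) * hex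
  rw [e2, integral_add (integrable_mul_ex hprod _) hqsum, integral_finsetSum _ fun ν _ => (hqh ν).1]
  simp only [(hqh _).2, Finset.sum_const_zero, add_zero]
  exact key

/-- Under the minimality condition a function in `L₂(f)` whose Fourier coefficients vanish on `Γ`
is a limit of trigonometric polynomials with frequencies off `Γ`. By duality, this follows from
the vanishing of the means of products of functions with complementary spectra. -/
lemma mem_L2s_of_fc (hf : IsSpectralDensity f) (hm : IsMinimal f) {s : ℕ} {N K : ℕ → ℕ}
    {h : ℝ → Fin T → ℂ} (hh : h ∈ L2 f)
    (h0 : ∀ ν, ∀ k ∈ Gam s N K, fc (fun x => h x ν) k = 0) : h ∈ L2s s N K f := by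
  refine (mem_L2s_iff hf).2 ⟨hh, ?_⟩
  rw [← Submodule.orthogonal_orthogonal_eq_closure, Submodule.mem_orthogonal]
  intro r hr
  rw [Submodule.mem_orthogonal] at hr
  have hW := fun ν => fc_root_mulVec hf r ν
  have key : ∀ᵐ x ∂freq, inner ℂ (emb f h x) (r x) = (root (f x) *ᵥ (r x).ofLp) ⬝ᵥ star (h x) := by
    filter_upwards [emb_ae hf hh, hf.2] with x h1 h2
    rw [h1]
    exact inner_root h2 _ _
  have hint := (L2.integrable_inner (𝕜 := ℂ) (emb f h) r).congr key
  rw [← inner_conj_symm, L2.inner_def, integral_congr_ae key,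
    integral_dotProduct_star_eq_zero (s := s) (N := N) (K := K)
      (fun ν => ((exists_fc_functional hf hm 0 ν).choose_spec h hh).1) (fun ν => (hW ν).1) h0
      (fun ν k hk => ?_) hint, map_zero]
  rw [(hW ν).2 k]
  exact hr _ (expv_mem_polySpan hf hk ν)

end Trig

/-! ### The functional and its symbol -/

section Symbol

variable {T : ℕ} {a : ℕ → ℂ}

open Matrix

lemma summable_vecCoeff (ha : Summable fun j => ‖a j‖) (ν : Fin T) :
    Summable fun j => ‖vecCoeff T a j ν‖ := by
  refine ha.comp_injective (i := fun j => (ν : ℕ) + 1 + j * T) fun i j hij => ?_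
  have hT : 0 < T := ν.pos
  simpa [hT.ne'] using hij

/-- The partial sums of the symbol `A`. -/
def symPoly (T : ℕ) (a : ℕ → ℂ) (n : ℕ) : ℤ →₀ (Fin T → ℂ) :=
  ∑ j ∈ Finset.range n, Finsupp.single (j : ℤ) (vecCoeff T a j)

lemma trigPoly_symPoly (n : ℕ) (x : ℝ) (ν : Fin T) :
    trigPoly (symPoly T a n) x ν = ∑ j ∈ Finset.range n, vecCoeff T a j ν * ex j x := by
  induction n with
  | zero => simp [symPoly, trigPoly]
  | succ n ih =>
    rw [symPoly, Finset.sum_range_succ, trigPoly_add, Pi.add_apply, Finset.sum_range_succ, ← ih,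
      symPoly]
    congr 1
    rw [trigPoly_eq, Finsupp.sum_single_index (by simp)]
    simp [mul_comm]

lemma hasSum_symA (ha : Summable fun j => ‖a j‖) (x : ℝ) (ν : Fin T) :
    HasSum (fun j : ℕ => vecCoeff T a j ν * ex j x) (symA T a x ν) := by
  have h : Summable fun j : ℕ => vecCoeff T a j ν * ex j x :=
    Summable.of_norm (by simpa using summable_vecCoeff ha ν)
  have := h.hasSum
  simpa only [symA, ex, Int.cast_natCast] using this

lemma tendsto_trigPoly_symPoly (ha : Summable fun j => ‖a j‖) (x : ℝ) (ν : Fin T) :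
    Tendsto (fun n => trigPoly (symPoly T a n) x ν) atTop (𝓝 (symA T a x ν)) := by
  simp only [trigPoly_symPoly]
  exact (hasSum_symA ha x ν).tendsto_sum_nat

lemma norm_trigPoly_symPoly_le (ha : Summable fun j => ‖a j‖) (n : ℕ) (x : ℝ) (ν : Fin T) :
    ‖trigPoly (symPoly T a n) x ν‖ ≤ ∑' j, ‖vecCoeff T a j ν‖ := by
  rw [trigPoly_symPoly]
  refine (norm_sum_le _ _).trans ?_
  simp only [norm_mul, norm_ex, mul_one]
  exact (summable_vecCoeff ha ν).sum_le_tsum _ fun j _ => norm_nonneg _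

lemma norm_symA_le (ha : Summable fun j => ‖a j‖) (x : ℝ) (ν : Fin T) :
    ‖symA T a x ν‖ ≤ ∑' j, ‖vecCoeff T a j ν‖ :=
  le_of_tendsto (tendsto_trigPoly_symPoly ha x ν).norm
    (.of_forall fun n => norm_trigPoly_symPoly_le ha n x ν)

lemma aemeasurable_symA (ha : Summable fun j => ‖a j‖) : AEMeasurable (symA T a) freq := by
  have hm : Measurable (symA T a) := by
    refine measurable_pi_iff.2 fun ν => ?_
    refine measurable_of_tendsto_metrizable (f := fun n x => trigPoly (symPoly T a n) x ν)
      (fun n => ?_) (tendsto_pi_nhds.2 fun x => tendsto_trigPoly_symPoly ha x ν)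
    exact ((continuous_apply ν).comp (continuous_trigPoly _)).measurable
  exact hm.aemeasurable

lemma symA_mem_L2 {f : ℝ → Matrix (Fin T) (Fin T) ℂ} (hf : IsSpectralDensity f)
    (ha : Summable fun j => ‖a j‖) : symA T a ∈ L2 f := by
  refine mem_L2_of_bounded hf (aemeasurable_symA ha)
    (M := √(∑ ν : Fin T, (∑' j, ‖vecCoeff T a j ν‖) ^ 2)) fun x => ?_
  rw [EuclideanSpace.norm_eq]
  refine Real.sqrt_le_sqrt (Finset.sum_le_sum fun ν _ => ?_)
  have := norm_symA_le ha x ν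
  simp only
  gcongr

lemma integrable_symA (ha : Summable fun j => ‖a j‖) (ν : Fin T) :
    Integrable (fun x => symA T a x ν) freq :=
  Integrable.of_bound (aemeasurable_entry (aemeasurable_symA ha) ν) _
    (.of_forall fun x => norm_symA_le ha x ν)

lemma symPoly_apply (n : ℕ) (k : ℤ) :
    symPoly T a n k = if 0 ≤ k ∧ k.toNat < n then extCoeff T a k else 0 := by
  simp only [symPoly, Finsupp.finsetSum_apply, Finsupp.single_apply, extCoeff]
  by_cases hk : 0 ≤ k
  · obtain ⟨m, rfl⟩ := Int.eq_ofNat_of_zero_le hk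
    simp
  · rw [if_neg (fun h => hk h.1)]
    refine Finset.sum_eq_zero fun j _ => if_neg ?_
    omega

lemma fc_symA (ha : Summable fun j => ‖a j‖) (ν : Fin T) (k : ℤ) :
    fc (fun x => symA T a x ν) k = 2 * Real.pi * extCoeff T a k ν := by
  have h1 := tendsto_fc_of_dominated (F := fun n x => trigPoly (symPoly T a n) x ν)
    (f := fun x => symA T a x ν) (b := fun _ => ∑' j, ‖vecCoeff T a j ν‖)
    (fun n => aemeasurable_entry (continuous_trigPoly _).aemeasurable ν) (integrable_const _)
    (fun n => .of_forall fun x => norm_trigPoly_symPoly_le ha n x ν)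
    (.of_forall fun x => tendsto_trigPoly_symPoly ha x ν) k
  refine tendsto_nhds_unique h1 (tendsto_const_nhds.congr' ?_)
  filter_upwards [eventually_gt_atTop k.toNat] with n hn
  rw [fc_trigPoly, symPoly_apply]
  by_cases hk : 0 ≤ k
  · rw [if_pos ⟨hk, hn⟩]
  · rw [if_neg (fun h => hk h.1), extCoeff, if_neg hk]

/-- Parseval's identity for an integrable function and the symbol `A`, whose Fourier series
converges absolutely. -/
lemma integral_dotProduct_star_symA (ha : Summable fun j => ‖a j‖) {C : ℝ → Fin T → ℂ}
    {c : ℤ → Fin T → ℂ} (hC : ∀ ν, Integrable (fun x => C x ν) freq)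
    (hc : ∀ ν k, fc (fun x => C x ν) k = 2 * Real.pi * c k ν) :
    ∫ x, C x ⬝ᵥ star (symA T a x) ∂freq = 2 * Real.pi * pair c (extCoeff T a) := by
  have hcb : ∀ ν k, ‖c k ν‖ ≤ ∫ x, ‖C x ν‖ ∂freq := by
    intro ν k
    have h1 : ‖fc (fun x => C x ν) k‖ ≤ ∫ x, ‖C x ν‖ ∂freq := by
      refine (norm_integral_le_integral_norm _).trans (le_of_eq ?_)
      simp
    rw [hc, norm_mul] at h1
    refine le_trans ?_ h1
    have : (1 : ℝ) ≤ ‖(2 * Real.pi : ℂ)‖ := by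
      rw [norm_mul, Complex.norm_ofNat, Complex.norm_real, Real.norm_of_nonneg Real.pi_pos.le]
      linarith [Real.pi_gt_three]
    exact le_mul_of_one_le_left (norm_nonneg _) this
  have hsum : Summable fun j : ℕ => ∑ ν, c j ν * conj (extCoeff T a j ν) := by
    refine summable_sum fun ν _ => Summable.of_norm_bounded
      ((summable_vecCoeff ha ν).mul_left (∫ x, ‖C x ν‖ ∂freq)) fun j => ?_
    rw [norm_mul, RCLike.norm_conj]
    have : extCoeff T a (j : ℤ) ν = vecCoeff T a j ν := by simp [extCoeff]
    rw [this]
    gcongr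
    exact hcb ν j
  have hpair : pair c (extCoeff T a) = ∑' j : ℕ, ∑ ν, c j ν * conj (extCoeff T a j ν) := by
    refine (Function.Injective.tsum_eq Nat.cast_injective fun k hk => ?_).symm
    by_contra h
    refine hk (Finset.sum_eq_zero fun ν _ => ?_)
    have : ¬ 0 ≤ k := fun h0 => h ⟨k.toNat, Int.toNat_of_nonneg h0⟩
    simp [extCoeff, this]
  have hlim := (hsum.hasSum.tendsto_sum_nat).const_mul (2 * Real.pi : ℂ)
  rw [← hpair] at hlim
  refine tendsto_nhds_unique ?_ hlim
  have hstep : ∀ n, ∫ x, C x ⬝ᵥ star (trigPoly (symPoly T a n) x) ∂freq =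
      2 * Real.pi * ∑ j ∈ Finset.range n, ∑ ν, c j ν * conj (extCoeff T a j ν) := by
    intro n
    have e1 : ∀ x, C x ⬝ᵥ star (trigPoly (symPoly T a n) x) =
        ∑ j ∈ Finset.range n, ∑ ν, conj (extCoeff T a j ν) * (C x ν * ex (-j) x) := by
      intro x
      rw [Finset.sum_comm]
      refine Finset.sum_congr rfl fun ν _ => ?_
      rw [Pi.star_apply, ← starRingEnd_apply, trigPoly_symPoly, map_sum, Finset.mul_sum]
      refine Finset.sum_congr rfl fun j _ => ?_
      rw [map_mul, conj_ex]
      simp only [extCoeff, Nat.cast_nonneg, if_true, Int.toNat_natCast]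
      ring
    simp only [e1]
    rw [integral_finsetSum _ fun j _ => integrable_finsetSum _ fun ν _ =>
      (integrable_mul_ex (hC ν) _).const_mul _, Finset.mul_sum]
    refine Finset.sum_congr rfl fun j _ => ?_
    rw [integral_finsetSum _ fun ν _ => (integrable_mul_ex (hC ν) _).const_mul _, Finset.mul_sum]
    refine Finset.sum_congr rfl fun ν _ => ?_
    rw [integral_const_mul]
    have := hc ν j
    rw [fc] at this
    rw [this]; ring
  simp only [← hstep]
  refine tendsto_integral_of_dominated_convergence
    (fun x => ∑ ν, ‖C x ν‖ * ∑' j, ‖vecCoeff T a j ν‖) (fun n => ?_)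
    (integrable_finsetSum _ fun ν _ => (hC ν).norm.mul_const _) (fun n => .of_forall fun x => ?_)
    (.of_forall fun x => ?_)
  · simp only [dotProduct]
    refine Finset.aestronglyMeasurable_fun_sum _ fun ν _ => (hC ν).1.mul ?_
    exact (aemeasurable_entry (continuous_trigPoly _).aemeasurable ν).star
  · refine (norm_sum_le _ _).trans (Finset.sum_le_sum fun ν _ => ?_)
    rw [norm_mul, Pi.star_apply, norm_star]
    gcongr
    exact norm_trigPoly_symPoly_le ha n x ν
  · refine tendsto_finsetSum _ fun ν _ => Tendsto.const_mul _ ?_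
    exact (tendsto_trigPoly_symPoly ha x ν).star

end Symbol

/-! ### The operator `B` and the spectral characteristic -/

section Operator

variable {T : ℕ} {f : ℝ → Matrix (Fin T) (Fin T) ℂ}

open Matrix

lemma Bapply_eq_fc (hg : IsSpectralDensity (invd f)) (x : ℤ →₀ (Fin T → ℂ)) (k : ℤ)
    (ν : Fin T) :
    Bapply f x k ν = (1 / (2 * Real.pi)) * fc (fun t => (trigPoly x t ᵥ* invd f t) ν) k := by
  have e1 : (fun t => (trigPoly x t ᵥ* invd f t) ν) =
      fun t => ∑ j ∈ x.support, ∑ μ, x j μ * (invd f t μ ν * ex j t) := by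
    ext t
    rw [Finset.sum_comm]
    simp only [vecMul, dotProduct, trigPoly, Finset.sum_mul]
    refine Finset.sum_congr rfl fun μ _ => Finset.sum_congr rfl fun j _ => ?_
    rw [ex]; ring
  rw [e1, fc_sum _ fun j _ => integrable_finsetSum _ fun μ _ =>
    (integrable_mul_ex (hg.1 μ ν) _).const_mul _]
  simp only [Bapply, Finset.sum_apply, mulVec, dotProduct, Finset.mul_sum]
  refine Finset.sum_congr rfl fun j _ => ?_
  rw [fc_sum _ fun μ _ => (integrable_mul_ex (hg.1 μ ν) _).const_mul _, Finset.mul_sum]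
  refine Finset.sum_congr rfl fun μ _ => ?_
  rw [fc_const_mul, fc_mul_ex (fun t => invd f t μ ν), Bcoeff, fc]
  simp only [ex_neg_eq, transpose_apply, invd]
  ring

lemma Bform_eq_norm (hg : IsSpectralDensity (invd f)) (x : ℤ →₀ (Fin T → ℂ)) :
    Bform f x = 1 / (2 * Real.pi) * ‖polyEmb hg x‖ ^ 2 := by
  have h1 : ∀ k ν, Bapply f x k ν =
      (1 / (2 * Real.pi)) * inner ℂ (emb (invd f) (expv k ν)) (polyEmb hg x) := fun k ν => by
    rw [Bapply_eq_fc hg, (fc_vecMul hg (trigPoly_mem_L2 hg x) ν).2]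
    rfl
  have h2 : ∑ k ∈ x.support, ∑ ν, Bapply f x k ν * conj (x k ν) =
      (1 / (2 * Real.pi)) * inner ℂ (polyEmb hg x) (polyEmb hg x) := by
    conv_rhs => enter [2, 2]; rw [polyEmb_eq_sum]
    rw [sum_inner, Finset.mul_sum]
    refine Finset.sum_congr rfl fun k _ => ?_
    rw [sum_inner, Finset.mul_sum]
    refine Finset.sum_congr rfl fun ν _ => ?_
    rw [inner_smul_left, h1]; ring
  rw [Bform, h2, inner_self_eq_norm_sq_to_K]
  have : (1 / (2 * Real.pi) * (‖polyEmb hg x‖ : ℂ) ^ 2 : ℂ) =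
      ((1 / (2 * Real.pi) * ‖polyEmb hg x‖ ^ 2 : ℝ) : ℂ) := by push_cast; ring
  exact (congrArg Complex.re this).trans (Complex.ofReal_re _)

lemma hasFourierSeries_iff {C : ℝ → Fin T → ℂ} {c : ℤ → Fin T → ℂ} :
    HasFourierSeries C c ↔ (∀ ν, Integrable (fun x => C x ν) freq) ∧
      ∀ ν k, fc (fun x => C x ν) k = 2 * Real.pi * c k ν := by
  rw [HasFourierSeries, forall_and]
  refine and_congr_right fun _ => forall_congr' fun ν => forall_congr' fun k => ?_
  simp only [ex_neg_eq, fc]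
  rw [one_div, inv_mul_eq_iff_eq_mul₀ (by simp)]

/-- If `c = B⁻¹ y`, then `c` is the sequence of Fourier coefficients of a function `C` in
`L₂(f⁻¹)`, the Fourier coefficients of `f⁻¹ᵀ C` on `Γ` are those of `y`, and `c` vanishes
off `Γ`. -/
lemma IsBInv.exists_function (hf : IsSpectralDensity f) (hm : IsMinimal f) {s : ℕ} {N K : ℕ → ℕ}
    {y c : ℤ → Fin T → ℂ} (hB : IsBInv s N K f y c) :
    (∃ C ∈ L2 (invd f), HasFourierSeries C c ∧
      ∀ ν, ∀ k ∈ Gam s N K, fc (fun x => (C x ᵥ* invd f x) ν) k = 2 * Real.pi * y k ν) ∧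
    ∀ k ∉ Gam s N K, c k = 0 := by
  have hg := isSpectralDensity_invd hf hm
  have hgm := isMinimal_invd hf hm
  obtain ⟨x, hx, hcau, hxc, hBy⟩ := hB
  constructor
  · have hC : CauchySeq fun n => polyEmb hg (x n) := by
      rw [cauchySeq_iff_tendsto_dist_atTop_0]
      have h1 : Tendsto (fun q : ℕ × ℕ => √(2 * Real.pi * Bform f (x q.1 - x q.2)))
          atTop (𝓝 0) := by
        have := (hcau.const_mul (2 * Real.pi)).sqrt
        simpa using this
      refine h1.congr fun q => ?_
      rw [Bform_eq_norm hg, ← mul_assoc, mul_one_div_cancel (by positivity), one_mul,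
        Real.sqrt_sq (norm_nonneg _), map_sub, dist_eq_norm]
    obtain ⟨r, hr⟩ := cauchySeq_tendsto_of_complete hC
    obtain ⟨C, hCL, rfl⟩ := exists_emb_eq hg hgm r
    refine ⟨C, hCL, hasFourierSeries_iff.2 ⟨fun ν => ?_, fun ν k => ?_⟩, fun ν k hk => ?_⟩
    · exact ((exists_fc_functional hg hgm 0 ν).choose_spec C hCL).1
    · obtain ⟨ξ, hξ⟩ := exists_fc_functional hg hgm k ν
      rw [(hξ C hCL).2]
      refine tendsto_nhds_unique (Tendsto.inner (𝕜 := ℂ) (tendsto_const_nhds (x := ξ)) hr) ?_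
      have h1 : ∀ n, inner ℂ ξ (polyEmb hg (x n)) = 2 * Real.pi * x n k ν := fun n => by
        rw [← fc_trigPoly, (hξ _ (trigPoly_mem_L2 hg (x n))).2]
        rfl
      simp only [h1]
      exact ((tendsto_pi_nhds.1 (hxc k)) ν).const_mul _
    · rw [(fc_vecMul hg hCL ν).2]
      refine tendsto_nhds_unique (Tendsto.inner (𝕜 := ℂ) tendsto_const_nhds hr) ?_
      have h1 : ∀ n, inner ℂ (emb (invd f) (expv k ν)) (polyEmb hg (x n)) =
          2 * Real.pi * Bapply f (x n) k ν := fun n => by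
        rw [Bapply_eq_fc hg, (fc_vecMul hg (trigPoly_mem_L2 hg _) ν).2, ← mul_assoc,
          mul_one_div_cancel (by simp), one_mul]
        rfl
      simp only [h1]
      exact ((tendsto_pi_nhds.1 (hBy k hk)) ν).const_mul _
  · intro k hk
    refine tendsto_nhds_unique (hxc k) ?_
    have : ∀ n, x n k = 0 := fun n => by
      by_contra h
      exact hk (hx n (by simpa using h))
    simp only [this]
    exact tendsto_const_nhds

lemma HasFourierSeries.ae_eq {C C' : ℝ → Fin T → ℂ} {c : ℤ → Fin T → ℂ}
    (h : HasFourierSeries C c) (h' : HasFourierSeries C' c) : C =ᵐ[freq] C' := by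
  rw [hasFourierSeries_iff] at h h'
  have : ∀ ν, ∀ᵐ x ∂freq, C x ν = C' x ν := by
    intro ν
    have := ae_eq_zero_of_fc ((h.1 ν).sub (h'.1 ν)) fun k => by
      have := fc_sub (h.1 ν) (h'.1 ν) k
      rw [h.2, h'.2, sub_self] at this
      exact this
    filter_upwards [this] with x hx
    exact sub_eq_zero.1 hx
  filter_upwards [ae_all_iff.2 this] with x hx
  exact funext hx

lemma L2_congr {f : ℝ → Matrix (Fin T) (Fin T) ℂ} {b b' : ℝ → Fin T → ℂ} (hb : b ∈ L2 f)
    (h : b =ᵐ[freq] b') : b' ∈ L2 f := by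
  refine ⟨hb.1.congr h, lt_of_le_of_lt (le_of_eq ?_) hb.2⟩
  rw [normSq, normSq]
  congr 1
  refine lintegral_congr_ae ?_
  filter_upwards [h] with x hx
  rw [hx]

lemma quad_vecMul_inv {F : Matrix (Fin T) (Fin T) ℂ} (hF : F.PosSemidef) (hdet : IsUnit F.det)
    (v : Fin T → ℂ) : quad F (v ᵥ* F⁻¹) = quad F⁻¹ v := by
  rw [quad_eq_re, quad_eq_re, vecMul_vecMul, nonsing_inv_mul _ hdet, vecMul_one, star_vecMul,
    conjTranspose_nonsing_inv, hF.1.eq, dotProduct_mulVec]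

/-- The properties of the spectral characteristic `h = A - f⁻¹ᵀ C`: it belongs to `L₂ˢ(f)`, the
error satisfies the Pythagorean identity, and the error of `h` is the real part of `⟨c, a⟩`. -/
lemma specChar_spec {a : ℕ → ℂ} (ha : Summable fun j => ‖a j‖) (hf : IsSpectralDensity f)
    (hm : IsMinimal f) {s : ℕ} {N K : ℕ → ℕ} {c : ℤ → Fin T → ℂ}
    (hB : IsBInv s N K f (extCoeff T a) c) {C : ℝ → Fin T → ℂ} (hC : HasFourierSeries C c) :
    specChar a f C ∈ L2s s N K f ∧
    (∀ g ∈ L2s s N K f, Delta a g f =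
      Delta a (specChar a f C) f + normSq f (fun x => g x - specChar a f C x)) ∧
    Delta a (specChar a f C) f = ENNReal.ofReal (pair c (extCoeff T a)).re := by
  have hg := isSpectralDensity_invd hf hm
  obtain ⟨⟨C', hC'L, hC', hC'y⟩, hc0⟩ := hB.exists_function hf hm
  have hCC' := hC'.ae_eq hC
  have hCL : C ∈ L2 (invd f) := L2_congr hC'L hCC'
  have hCy : ∀ ν, ∀ k ∈ Gam s N K,
      fc (fun x => (C x ᵥ* invd f x) ν) k = 2 * Real.pi * extCoeff T a k ν := by
    intro ν k hk
    rw [← hC'y ν k hk]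
    refine fc_congr ?_ k
    filter_upwards [hCC'] with x hx
    rw [hx]
  obtain ⟨hCi, hCc⟩ := hasFourierSeries_iff.1 hC
  -- the error `A - h`
  set d : ℝ → Fin T → ℂ := fun x => C x ᵥ* (f x)⁻¹ with hd
  have hdi : ∀ ν, Integrable (fun x => d x ν) freq := fun ν => (fc_vecMul hg hCL ν).1
  have hdL : d ∈ L2 f := by
    refine ⟨aemeasurable_pi_iff.2 fun ν => (hdi ν).1.aemeasurable, ?_⟩
    refine lt_of_le_of_lt (le_of_eq ?_) hCL.2
    rw [normSq, normSq]
    congr 1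
    refine lintegral_congr_ae ?_
    filter_upwards [hf.2, hm.1] with x hx hdet
    rw [hd, quad_vecMul_inv hx hdet]
    rfl
  have hAL := symA_mem_L2 hf ha
  have hspec : specChar a f C = fun x => symA T a x - d x := rfl
  have hhL : specChar a f C ∈ L2 f := hspec ▸ L2_sub hf hAL hdL
  have hhs : specChar a f C ∈ L2s s N K f := by
    refine mem_L2s_of_fc hf hm hhL fun ν k hk => ?_
    have := fc_sub (integrable_symA ha ν) (hdi ν) k
    rw [fc_symA ha, show fc (fun x => d x ν) k = _ from hCy ν k hk, sub_self] at this
    exact this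
  have hdf : ∀ᵐ x ∂freq, d x ᵥ* f x = C x := by
    filter_upwards [hm.1] with x hdet
    rw [hd, vecMul_vecMul, nonsing_inv_mul _ hdet, vecMul_one]
  have horth : emb f d ∈ (polySpan hf (observed s N K)).topologicalClosureᗮ := by
    rw [Submodule.orthogonal_closure, Submodule.mem_orthogonal, polySpan_eq_span]
    intro u hu
    induction hu using Submodule.span_induction with
    | mem u hu =>
      obtain ⟨k, hk, ν, rfl⟩ := hu
      rw [← (fc_vecMul hf hdL ν).2]
      have h1 : fc (fun x => (d x ᵥ* f x) ν) k = fc (fun x => C x ν) k := by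
        refine fc_congr ?_ k
        filter_upwards [hdf] with x hx
        rw [hx]
      rw [h1, hCc, hc0 k (not_mem_Gam_iff.2 hk)]
      simp
    | zero => exact inner_zero_left _
    | add u v _ _ hu hv => rw [inner_add_left, hu, hv, add_zero]
    | smul a u _ hu => rw [inner_smul_left, hu, mul_zero]
  have horth' : ∀ g ∈ L2s s N K f, inner ℂ (emb f g) (emb f d) = 0 := fun g hg' =>
    (Submodule.mem_orthogonal _ _).1 horth _ ((mem_L2s_iff hf).1 hg').2
  have hDelta : Delta a (specChar a f C) f = normSq f d := by
    rw [Delta, hspec]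
    simp only [sub_sub_cancel]
  refine ⟨hhs, fun g hgs => ?_, ?_⟩
  · have hgL := ((mem_L2s_iff hf).1 hgs).1
    have he := L2_sub hf hgL hhL
    have h1 : (fun x => symA T a x - g x) =
        fun x => d x - (g x - specChar a f C x) := by
      ext1 x; rw [hspec]; simp only; abel
    rw [hDelta, Delta, h1, normSq_eq_norm_emb hf (L2_sub hf hdL he), normSq_eq_norm_emb hf hdL,
      normSq_eq_norm_emb hf he, ← ENNReal.ofReal_add (by positivity) (by positivity),
      emb_sub hf hdL he, emb_sub hf hgL hhL, ← mul_add]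
    congr 2
    have h2 : inner ℂ (emb f d) (emb f g - emb f (specChar a f C)) = 0 := by
      rw [inner_sub_right, ← inner_conj_symm, horth' g hgs, ← inner_conj_symm, horth' _ hhs]
      simp
    have h3 := norm_sub_sq (𝕜 := ℂ) (emb f d) (emb f g - emb f (specChar a f C))
    rw [h2] at h3
    simpa using h3
  · rw [hDelta, normSq_eq_norm_emb hf hdL]
    congr 1
    have h1 : inner ℂ (emb f d) (emb f d) = inner ℂ (emb f (symA T a)) (emb f d) := by
      have := horth' _ hhs
      rw [hspec, emb_sub hf hAL hdL, inner_sub_left, sub_eq_zero] at this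
      exact this.symm
    rw [inner_emb hf hdL hAL] at h1
    have h2 : ∫ x, (d x ᵥ* f x) ⬝ᵥ star (symA T a x) ∂freq =
        ∫ x, C x ⬝ᵥ star (symA T a x) ∂freq := by
      refine integral_congr_ae ?_
      filter_upwards [hdf] with x hx
      rw [hx]
    rw [h2, integral_dotProduct_star_symA ha hCi hCc, inner_self_eq_norm_sq_to_K] at h1
    have h3 := congrArg Complex.re h1
    have h4 : (2 * Real.pi * pair c (extCoeff T a) : ℂ).re =
        2 * Real.pi * (pair c (extCoeff T a)).re := by
      have : (2 * Real.pi : ℂ) = ((2 * Real.pi : ℝ) : ℂ) := by push_cast; rfl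
      rw [this, Complex.re_ofReal_mul]
    have h5 : ((‖emb f d‖ : ℂ) ^ 2).re = ‖emb f d‖ ^ 2 := by
      rw [← Complex.ofReal_pow, Complex.ofReal_re]
    rw [h4] at h3
    have h6 := h5.symm.trans h3
    rw [h6, ← mul_assoc, one_div_mul_cancel (by positivity), one_mul]

end Operator

/-! ### Least favorable densities and minimax estimates -/

section Minimax

variable {T : ℕ} {a : ℕ → ℂ} {f : ℝ → Matrix (Fin T) (Fin T) ℂ}

open Matrix

lemma ofReal_mul_norm_sq_tendsto_zero_iff {E : Type*} [SeminormedAddCommGroup E] {c : ℝ}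
    (hc : 0 < c) {x : E} {y : ℕ → E} :
    Tendsto (fun n => ENNReal.ofReal (c * ‖x - y n‖ ^ 2)) atTop (𝓝 0) ↔
      Tendsto y atTop (𝓝 x) := by
  rw [tendsto_iff_norm_sub_tendsto_zero]
  constructor
  · intro h
    have h1 := (ENNReal.tendsto_toReal ENNReal.zero_ne_top).comp h
    simp only [ENNReal.toReal_zero] at h1
    have h2 := (h1.div_const c).sqrt
    simp only [zero_div, Real.sqrt_zero] at h2
    refine h2.congr fun n => ?_
    simp only [Function.comp]
    rw [ENNReal.toReal_ofReal (by positivity), mul_div_cancel_left₀ _ hc.ne',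
      Real.sqrt_sq (norm_nonneg _), norm_sub_rev]
  · intro h
    have h1 := ENNReal.tendsto_ofReal ((h.pow 2).const_mul c)
    simp only [ne_eq, OfNat.ofNat_ne_zero, not_false_eq_true, zero_pow, mul_zero,
      ENNReal.ofReal_zero] at h1
    exact h1.congr fun n => by rw [norm_sub_rev]

lemma isOptimal_specChar (ha : Summable fun j => ‖a j‖) (hf : IsSpectralDensity f)
    (hm : IsMinimal f) {s : ℕ} {N K : ℕ → ℕ} {c : ℤ → Fin T → ℂ}
    (hB : IsBInv s N K f (extCoeff T a) c) {C : ℝ → Fin T → ℂ} (hC : HasFourierSeries C c) :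
    IsOptimal s N K a f (specChar a f C) := by
  have h := specChar_spec ha hf hm hB hC
  refine ⟨h.1, fun g hg => ?_⟩
  rw [h.2.1 g hg]
  exact le_self_add

lemma IsOptimal.deltaOpt_eq {s : ℕ} {N K : ℕ → ℕ} {h : ℝ → Fin T → ℂ}
    (hh : IsOptimal s N K a f h) : DeltaOpt s N K a f = Delta a h f :=
  le_antisymm (iInf₂_le h hh.1) (le_iInf₂ hh.2)

/-- The optimal error is the functional of `f` which `f₀` maximises. -/
lemma deltaOpt_eq (ha : Summable fun j => ‖a j‖) (hf : IsSpectralDensity f)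
    (hm : IsMinimal f) {s : ℕ} {N K : ℕ → ℕ} {c : ℤ → Fin T → ℂ}
    (hB : IsBInv s N K f (extCoeff T a) c) :
    DeltaOpt s N K a f = ENNReal.ofReal (pair c (extCoeff T a)).re := by
  obtain ⟨⟨C, -, hC, -⟩, -⟩ := hB.exists_function hf hm
  rw [(isOptimal_specChar ha hf hm hB hC).deltaOpt_eq, (specChar_spec ha hf hm hB hC).2.2]

lemma aemeasurable_quad (hf : IsSpectralDensity f) {b : ℝ → Fin T → ℂ} (hb : AEMeasurable b freq) :
    AEMeasurable (fun x => ENNReal.ofReal (quad (f x) (b x))) freq := by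
  refine (((aestronglyMeasurable_wt hf hb).norm.pow 2).aemeasurable.ennreal_ofReal).congr ?_
  filter_upwards [hf.2] with x hx
  rw [quad_eq_norm hx]
  rfl

lemma continuous_ofReal_quad (F : Matrix (Fin T) (Fin T) ℂ) :
    Continuous fun v : Fin T → ℂ => ENNReal.ofReal (quad F v) :=
  ENNReal.continuous_ofReal.comp (by unfold quad; fun_prop)

lemma quad_add_smul (F G : Matrix (Fin T) (Fin T) ℂ) (α β : ℝ) (v : Fin T → ℂ) :
    quad (α • F + β • G) v = α * quad F v + β * quad G v := by
  rw [quad_eq_re, quad_eq_re, quad_eq_re, vecMul_add, vecMul_smul, vecMul_smul, add_dotProduct,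
    smul_dotProduct, smul_dotProduct, Complex.add_re, Complex.smul_re, Complex.smul_re,
    smul_eq_mul, smul_eq_mul]

lemma normSq_add_smul {f₁ f₂ : ℝ → Matrix (Fin T) (Fin T) ℂ} (h₁ : IsSpectralDensity f₁)
    (h₂ : IsSpectralDensity f₂) {α β : ℝ} (hα : 0 ≤ α) (hβ : 0 ≤ β) {b : ℝ → Fin T → ℂ}
    (hb : AEMeasurable b freq) :
    normSq (α • f₁ + β • f₂) b =
      ENNReal.ofReal α * normSq f₁ b + ENNReal.ofReal β * normSq f₂ b := by
  have h : ∫⁻ x, ENNReal.ofReal (quad ((α • f₁ + β • f₂) x) (b x)) ∂freq =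
      ENNReal.ofReal α * ∫⁻ x, ENNReal.ofReal (quad (f₁ x) (b x)) ∂freq +
      ENNReal.ofReal β * ∫⁻ x, ENNReal.ofReal (quad (f₂ x) (b x)) ∂freq := by
    rw [← lintegral_const_mul' _ _ ENNReal.ofReal_ne_top,
      ← lintegral_const_mul' _ _ ENNReal.ofReal_ne_top,
      ← lintegral_add_left' ((aemeasurable_quad h₁ hb).const_mul _)]
    refine lintegral_congr_ae ?_
    filter_upwards [h₁.2, h₂.2] with x hx₁ hx₂
    have e1 : 0 ≤ quad (f₁ x) (b x) := by rw [quad_eq_norm hx₁]; positivity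
    have e2 : 0 ≤ quad (f₂ x) (b x) := by rw [quad_eq_norm hx₂]; positivity
    rw [← ENNReal.ofReal_mul hα, ← ENNReal.ofReal_mul hβ,
      ← ENNReal.ofReal_add (by positivity) (by positivity)]
    exact congrArg _ (quad_add_smul _ _ _ _ _)
  rw [normSq, h, normSq, normSq]
  ring

lemma L2s_mono {f₁ f₂ : ℝ → Matrix (Fin T) (Fin T) ℂ} {s : ℕ} {N K : ℕ → ℕ} {κ : ℝ≥0∞}
    (hκ : κ ≠ ∞)
    (hle : ∀ b, AEMeasurable b freq → normSq f₁ b ≤ κ * normSq f₂ b) :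
    L2s s N K f₂ ⊆ L2s s N K f₁ := by
  intro h hh
  refine ⟨⟨hh.1.1, (hle h hh.1.1).trans_lt (ENNReal.mul_lt_top hκ.lt_top hh.1.2)⟩, fun ε hε => ?_⟩
  obtain ⟨p, hp, hpε⟩ := hh.2 (ε / κ) (ENNReal.div_pos hε.ne' hκ)
  refine ⟨p, hp, (hle _ (hh.1.1.sub (continuous_trigPoly p).aemeasurable)).trans_lt ?_⟩
  rw [mul_comm]
  exact ENNReal.mul_lt_of_lt_div hpε

/-- Lower semicontinuity of the error along sequences converging in `L₂(f₀)`. -/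
lemma delta_le_of_tendsto {f₀ : ℝ → Matrix (Fin T) (Fin T) ℂ} (ha : Summable fun j => ‖a j‖)
    (hf₀ : IsSpectralDensity f₀) (hm₀ : IsMinimal f₀) (hf : IsSpectralDensity f)
    {h : ℕ → ℝ → Fin T → ℂ} {h₀ : ℝ → Fin T → ℂ} (hh : ∀ n, AEMeasurable (h n) freq)
    (hh₀ : AEMeasurable h₀ freq)
    (hlim : Tendsto (fun n => normSq f₀ (fun x => h n x - h₀ x)) atTop (𝓝 0)) {A : ℝ≥0∞}
    (hA : ∀ n, Delta a (h n) f ≤ A) : Delta a h₀ f ≤ A := by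
  have hlim' : Tendsto (fun n => eLpNorm (wt f₀ (fun x => h n x - h₀ x) - 0) 2 freq)
      atTop (𝓝 0) := by
    simp only [normSq_eq_eLpNorm hf₀] at hlim
    have h1 := ENNReal.Tendsto.const_mul (a := (ENNReal.ofReal (1 / (2 * Real.pi)))⁻¹) hlim
      (Or.inr (ENNReal.inv_ne_top.2 ofReal_pi_ne_zero))
    simp only [← mul_assoc, ENNReal.inv_mul_cancel ofReal_pi_ne_zero ENNReal.ofReal_ne_top, one_mul,
      mul_zero] at h1
    have h2 := h1.ennrpow_const (1 / 2)
    rw [ENNReal.zero_rpow_of_pos (by norm_num)] at h2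
    refine h2.congr fun n => ?_
    rw [← ENNReal.rpow_natCast, ← ENNReal.rpow_mul]
    simp
  obtain ⟨ns, -, hns⟩ := exists_subseq_tendsto_ae two_ne_zero
    (fun n => aestronglyMeasurable_wt hf₀ ((hh n).sub hh₀)) aestronglyMeasurable_zero hlim'
  have hae : ∀ᵐ x ∂freq, Tendsto (fun n => h (ns n) x) atTop (𝓝 (h₀ x)) := by
    filter_upwards [hns, hf₀.2, hm₀.1] with x hx hpsd hdet
    have h1 : Tendsto (fun n => WithLp.toLp 2 (h (ns n) x - h₀ x)) atTop (𝓝 0) := by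
      refine squeeze_zero_norm (a := fun n => √((f₀ x)⁻¹.trace.re *
        ‖wt f₀ (fun x => h (ns n) x - h₀ x) x‖ ^ 2)) (fun n => ?_) ?_
      · exact Real.le_sqrt_of_sq_le (norm_sq_le_trace_inv_mul hpsd hdet _)
      · have := ((hx.norm.pow 2).const_mul ((f₀ x)⁻¹.trace.re)).sqrt
        have e : √((f₀ x)⁻¹.trace.re * ‖(0 : ℝ → EuclideanSpace ℂ (Fin T)) x‖ ^ 2) = 0 := by simp
        rw [e] at this
        exact this
    have h2 := ((PiLp.continuous_ofLp 2 _).tendsto _).comp h1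
    have h3 : Tendsto (fun n => h (ns n) x - h₀ x) atTop (𝓝 0) := h2
    simpa using h3.add_const (h₀ x)
  have hquad : ∀ᵐ x ∂freq, Tendsto
      (fun n => ENNReal.ofReal (quad (f x) (symA T a x - h (ns n) x))) atTop
      (𝓝 (ENNReal.ofReal (quad (f x) (symA T a x - h₀ x)))) := by
    filter_upwards [hae] with x hx
    exact ((continuous_ofReal_quad (f x)).tendsto _).comp (hx.const_sub _)
  have hAm := aemeasurable_symA (T := T) ha
  calc Delta a h₀ f = ENNReal.ofReal (1 / (2 * Real.pi)) *
        ∫⁻ x, liminf (fun n => ENNReal.ofReal (quad (f x) (symA T a x - h (ns n) x))) atTop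
          ∂freq := by
        rw [Delta, normSq]
        congr 1
        refine lintegral_congr_ae ?_
        filter_upwards [hquad] with x hx
        exact hx.liminf_eq.symm
    _ ≤ ENNReal.ofReal (1 / (2 * Real.pi)) *
        liminf (fun n => ∫⁻ x, ENNReal.ofReal (quad (f x) (symA T a x - h (ns n) x)) ∂freq)
          atTop := by
        gcongr
        exact lintegral_liminf_le' fun n => aemeasurable_quad hf (hAm.sub (hh _))
    _ ≤ A := by
        rw [mul_comm, ← ENNReal.le_div_iff_mul_le (Or.inl ofReal_pi_ne_zero)
          (Or.inl ENNReal.ofReal_ne_top)]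
        refine liminf_le_of_frequently_le' (Frequently.of_forall fun n => ?_)
        rw [ENNReal.le_div_iff_mul_le (Or.inl ofReal_pi_ne_zero)
          (Or.inl ENNReal.ofReal_ne_top), mul_comm]
        exact hA (ns n)

/-- The saddle point inequality: moving from the least favorable density `f₀` towards `f` does not
increase the optimal error, which forces the error of the optimal estimate for `f₀` at `f` to be at
most its error at `f₀`. -/
lemma delta_le_of_convex {s : ℕ} {N K : ℕ → ℕ} (ha : Summable fun j => ‖a j‖)
    {D : Set (ℝ → Matrix (Fin T) (Fin T) ℂ)} (hdens : ∀ f ∈ D, IsSpectralDensity f)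
    (hmin : ∀ f ∈ D, IsMinimal f) {c : (ℝ → Matrix (Fin T) (Fin T) ℂ) → ℤ → Fin T → ℂ}
    (hc : ∀ f ∈ D, IsBInv s N K f (extCoeff T a) (c f))
    {f₀ : ℝ → Matrix (Fin T) (Fin T) ℂ} (hf₀ : f₀ ∈ D)
    (hmax : ∀ f ∈ D, (pair (c f) (extCoeff T a)).re ≤ (pair (c f₀) (extCoeff T a)).re)
    (hD : Convex ℝ D) {C : ℝ → Fin T → ℂ} (hC : HasFourierSeries C (c f₀)) (hf : f ∈ D) :
    Delta a (specChar a f₀ C) f ≤ Delta a (specChar a f₀ C) f₀ := by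
  obtain ⟨hs₀, hpyth, hval⟩ := specChar_spec ha (hdens f₀ hf₀) (hmin f₀ hf₀) (hc f₀ hf₀) hC
  set h₀ := specChar a f₀ C
  have hA : Delta a h₀ f₀ ≠ ∞ := by rw [hval]; exact ENNReal.ofReal_ne_top
  -- optimal estimates for the densities on the segment between `f₀` and `f`
  have hstep : ∀ n : ℕ, ∃ h : ℝ → Fin T → ℂ, AEMeasurable h freq ∧
      normSq f₀ (fun x => h x - h₀ x) ≤ ENNReal.ofReal (2 * (n + 2 : ℝ)⁻¹) * Delta a h₀ f₀ ∧
      Delta a h f ≤ Delta a h₀ f₀ := by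
    intro n
    set ε : ℝ := (n + 2 : ℝ)⁻¹ with hε
    have hε0 : 0 < ε := by positivity
    -- the density `(1 - ε) f₀ + ε f` then dominates `f₀ / 2`
    have hε2 : ε ≤ 1 / 2 := by
      rw [hε, one_div]
      exact inv_anti₀ two_pos (by linarith [n.cast_nonneg (α := ℝ)])
    set fε := (1 - ε) • f₀ + ε • f with hfε
    have hfεD : fε ∈ D := hD hf₀ hf (by linarith) hε0.le (by ring)
    obtain ⟨⟨Cε, -, hCε, -⟩, -⟩ :=
      (hc fε hfεD).exists_function (hdens fε hfεD) (hmin fε hfεD)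
    obtain ⟨hsε, -, hvalε⟩ :=
      specChar_spec ha (hdens fε hfεD) (hmin fε hfεD) (hc fε hfεD) hCε
    set h := specChar a fε Cε
    have hlin : ∀ b, AEMeasurable b freq → normSq fε b =
        ENNReal.ofReal (1 - ε) * normSq f₀ b + ENNReal.ofReal ε * normSq f b := fun b hb =>
      normSq_add_smul (hdens f₀ hf₀) (hdens f hf) (by linarith) hε0.le hb
    have hs : h ∈ L2s s N K f₀ := by
      refine L2s_mono (κ := 2) (by simp) (fun b hb => ?_) hsε
      rw [hlin b hb, mul_add, ← mul_assoc]
      refine le_trans ?_ le_self_add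
      have h2 : (1 : ℝ≥0∞) ≤ 2 * ENNReal.ofReal (1 - ε) := by
        rw [← ENNReal.ofReal_ofNat, ← ENNReal.ofReal_mul (by norm_num), ENNReal.one_le_ofReal]
        linarith
      exact le_mul_of_one_le_left' h2
    have hle : ENNReal.ofReal (1 - ε) * Delta a h f₀ + ENNReal.ofReal ε * Delta a h f ≤
        Delta a h₀ f₀ := by
      have h1 := hlin (fun x => symA T a x - h x) ((aemeasurable_symA ha).sub hs.1.1)
      rw [Delta, Delta, ← h1, hval]
      refine le_trans (le_of_eq hvalε) (ENNReal.ofReal_le_ofReal (hmax fε hfεD))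
    rw [hpyth h hs] at hle
    refine ⟨h, hs.1.1, ?_⟩
    generalize normSq f₀ (fun x => h x - h₀ x) = η at *
    generalize Delta a h f = X at *
    generalize Delta a h₀ f₀ = A at *
    -- both conclusions follow from `(1 - ε) (A + η) + ε X ≤ A`
    have hη : η ≠ ∞ := by
      rintro rfl
      rw [add_top, ENNReal.mul_top (by simp; linarith), top_add] at hle
      exact hA (top_le_iff.1 hle)
    have hX : X ≠ ∞ := by
      rintro rfl
      rw [ENNReal.mul_top (by simpa using hε0), add_top] at hle
      exact hA (top_le_iff.1 hle)
    lift η to NNReal using hη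
    lift X to NNReal using hX
    lift A to NNReal using hA
    have hle' : (1 - ε) * (A + η) + ε * X ≤ (A : ℝ) := by
      have e1 : ENNReal.ofReal ((1 - ε) * (A + η) + ε * X) ≤ ENNReal.ofReal A := by
        rw [ENNReal.ofReal_add (mul_nonneg (by linarith) (by positivity)) (by positivity),
          ENNReal.ofReal_mul (by linarith), ENNReal.ofReal_mul hε0.le,
          ENNReal.ofReal_add (by positivity) (by positivity)]
        simpa using hle
      exact (ENNReal.ofReal_le_ofReal_iff (by positivity)).1 e1
    have e2 : (0 : ℝ) ≤ η := η.2
    have e3 : (0 : ℝ) ≤ X := X.2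
    constructor
    · have : (η : ℝ) ≤ 2 * ε * A := by nlinarith [mul_nonneg hε0.le e3]
      rw [← ENNReal.ofReal_coe_nnreal (p := η), ← ENNReal.ofReal_coe_nnreal (p := A),
        ← ENNReal.ofReal_mul (by positivity)]
      exact ENNReal.ofReal_le_ofReal this
    · have h5 : ε * X ≤ ε * A := by nlinarith
      exact_mod_cast le_of_mul_le_mul_left h5 hε0
  choose h hhm hh0 hhf using hstep
  refine delta_le_of_tendsto ha (hdens f₀ hf₀) (hmin f₀ hf₀) (hdens f hf) hhm hs₀.1.1 ?_ hhf
  refine tendsto_of_tendsto_of_tendsto_of_le_of_le tendsto_const_nhds ?_ (fun _ => zero_le) hh0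
  have h1 : Tendsto (fun n : ℕ => 2 * (n + 2 : ℝ)⁻¹) atTop (𝓝 0) := by
    have : Tendsto (fun n : ℕ => (n + 2 : ℝ)⁻¹) atTop (𝓝 0) :=
      (tendsto_atTop_add_const_right _ _ tendsto_natCast_atTop_atTop).inv_tendsto_atTop
    simpa using this.const_mul 2
  have h2 := ENNReal.Tendsto.mul_const (ENNReal.tendsto_ofReal h1) (Or.inr hA)
  simpa using h2

end Minimax

/-! ### Linear estimates of periodically correlated sequences -/

section Random

variable {Ω : Type*} [MeasurableSpace Ω] {P : Measure Ω} {T : ℕ} {ζ : ℤ → Ω → ℂ} {a : ℕ → ℂ}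
  {f : ℝ → Matrix (Fin T) (Fin T) ℂ}

open Matrix

lemma msDist_eq {X Y : Ω → ℂ} {x y : Lp ℂ 2 P} (hX : x =ᵐ[P] X) (hY : y =ᵐ[P] Y) :
    msDist P X Y = ENNReal.ofReal (‖x - y‖ ^ 2) := by
  rw [Lp.norm_def, ENNReal.ofReal_pow ENNReal.toReal_nonneg,
    ENNReal.ofReal_toReal (Lp.eLpNorm_ne_top _), eLpNorm_two_sq, msDist]
  refine lintegral_congr_ae ?_
  filter_upwards [hX, hY, Lp.coeFn_sub x y] with ω h1 h2 h3
  rw [h3, Pi.sub_apply, h1, h2]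

lemma tendsto_msDist_iff {X : Ω → ℂ} {Y : ℕ → Ω → ℂ} {x : Lp ℂ 2 P} {y : ℕ → Lp ℂ 2 P}
    (hX : x =ᵐ[P] X) (hY : ∀ n, y n =ᵐ[P] Y n) :
    Tendsto (fun n => msDist P X (Y n)) atTop (𝓝 0) ↔ Tendsto y atTop (𝓝 x) := by
  simp only [msDist_eq hX (hY _)]
  simpa using ofReal_mul_norm_sq_tendsto_zero_iff one_pos (x := x) (y := y)

/-- The values of the sequence as elements of `L²(P)`. -/
def rv (hζ : IsPC T P ζ) (n : ℤ) : Lp ℂ 2 P := (hζ.memLp n).toLp (ζ n)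

/-- The values of the blocked sequence as elements of `L²(P)`. -/
def rvBlock (hζ : IsPC T P ζ) (n : ℤ) (ν : Fin T) : Lp ℂ 2 P := rv hζ (n * T + (ν : ℕ) + 1)

lemma rvBlock_ae (hζ : IsPC T P ζ) (n : ℤ) (ν : Fin T) : rvBlock hζ n ν =ᵐ[P] block ζ n ν :=
  (hζ.memLp _).coeFn_toLp

/-- The linear combination `∑_j p(j)ᵀ ζ(j)` of the blocked sequence. -/
def rvPoly (hζ : IsPC T P ζ) : (ℤ →₀ (Fin T → ℂ)) →ₗ[ℂ] Lp ℂ 2 P :=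
  Finsupp.lsum ℂ fun j => ∑ ν, (LinearMap.proj ν : (Fin T → ℂ) →ₗ[ℂ] ℂ).smulRight (rvBlock hζ j ν)

lemma rvPoly_apply (hζ : IsPC T P ζ) (p : ℤ →₀ (Fin T → ℂ)) :
    rvPoly hζ p = ∑ j ∈ p.support, ∑ ν, p j ν • rvBlock hζ j ν := by
  simp [rvPoly, Finsupp.sum]

lemma rvPoly_ae (hζ : IsPC T P ζ) (p : ℤ →₀ (Fin T → ℂ)) :
    rvPoly hζ p =ᵐ[P] fun ω => ∑ j ∈ p.support, ∑ ν, p j ν * block ζ j ν ω := by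
  rw [rvPoly_apply]
  have h1 : ∀ j ν, (p j ν • rvBlock hζ j ν : Lp ℂ 2 P) =ᵐ[P] fun ω => p j ν * block ζ j ν ω := by
    intro j ν
    filter_upwards [Lp.coeFn_smul (p j ν) (rvBlock hζ j ν), rvBlock_ae hζ j ν] with ω h1 h2
    rw [h1, Pi.smul_apply, h2, smul_eq_mul]
  have h2 : ∀ j, ((∑ ν, p j ν • rvBlock hζ j ν : Lp ℂ 2 P) : Ω → ℂ) =ᵐ[P]
      fun ω => ∑ ν, p j ν * block ζ j ν ω := by
    intro j
    refine (Lp.coeFn_finsetSum _ _).trans ?_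
    filter_upwards [ae_all_iff.2 (h1 j)] with ω hω
    simp [hω]
  refine (Lp.coeFn_finsetSum _ _).trans ?_
  filter_upwards [ae_all_iff.2 h2] with ω hω
  rw [Finset.sum_apply]
  exact Finset.sum_congr rfl fun j _ => hω j

lemma inner_rvBlock (hζ : IsPC T P ζ) (hf : IsSpectralDensity f) (hd : HasBlockDensity P ζ f)
    (j k : ℤ) (ν μ : Fin T) :
    inner ℂ (rvBlock hζ k μ) (rvBlock hζ j ν) =
      (1 / (2 * Real.pi)) * inner ℂ (emb f (expv k μ)) (emb f (expv j ν)) := by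
  rw [inner_emb hf (expv_mem_L2 hf j ν) (expv_mem_L2 hf k μ), L2.inner_def]
  have h1 : ∫ ω, inner ℂ (rvBlock hζ k μ ω) (rvBlock hζ j ν ω) ∂P =
      ∫ ω, block ζ j ν ω * conj (block ζ k μ ω) ∂P := by
    refine integral_congr_ae ?_
    filter_upwards [rvBlock_ae hζ k μ, rvBlock_ae hζ j ν] with ω h1 h2
    rw [h1, h2, RCLike.inner_apply]
  rw [h1, hd j k ν μ]
  congr 1
  refine integral_congr_ae (.of_forall fun x => ?_)
  simp only [dotProduct_star_expv]
  simp only [expv, smul_vecMul, Pi.smul_apply, single_one_vecMul, smul_eq_mul]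
  have := ex_add j (-k) x
  rw [← sub_eq_add_neg] at this
  change ex (j - k) x * f x ν μ = ex j x * f x ν μ * ex (-k) x
  rw [this]; ring

/-- Linear combinations of the blocked sequence are isometric to trigonometric polynomials in
`L₂(f)`. -/
lemma norm_rvPoly_sq (hζ : IsPC T P ζ) (hf : IsSpectralDensity f) (hd : HasBlockDensity P ζ f)
    (p : ℤ →₀ (Fin T → ℂ)) :
    ‖rvPoly hζ p‖ ^ 2 = 1 / (2 * Real.pi) * ‖polyEmb hf p‖ ^ 2 := by
  have h : inner ℂ (rvPoly hζ p) (rvPoly hζ p) =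
      (1 / (2 * Real.pi)) * inner ℂ (polyEmb hf p) (polyEmb hf p) := by
    rw [rvPoly_apply, polyEmb_eq_sum]
    simp only [sum_inner, inner_sum, inner_smul_left, inner_smul_right,
      inner_rvBlock hζ hf hd, Finset.mul_sum]
    refine Finset.sum_congr rfl fun i _ => Finset.sum_congr rfl fun i' _ =>
      Finset.sum_congr rfl fun j _ => Finset.sum_congr rfl fun j' _ => ?_
    ring
  rw [inner_self_eq_norm_sq_to_K, inner_self_eq_norm_sq_to_K] at h
  have h' : ((‖rvPoly hζ p‖ ^ 2 : ℝ) : ℂ) =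
      ((1 / (2 * Real.pi) * ‖polyEmb hf p‖ ^ 2 : ℝ) : ℂ) := by
    push_cast
    exact h
  exact Complex.ofReal_injective h'

lemma tendsto_polyEmb_symPoly (ha : Summable fun j => ‖a j‖) (hf : IsSpectralDensity f) :
    Tendsto (fun n => polyEmb hf (symPoly T a n)) atTop (𝓝 (emb f (symA T a))) := by
  have hpi : (0 : ℝ) < 1 / (2 * Real.pi) := by positivity
  rw [← ofReal_mul_norm_sq_tendsto_zero_iff hpi]
  have hA := symA_mem_L2 hf ha
  have e1 : ∀ n, ENNReal.ofReal (1 / (2 * Real.pi) *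
      ‖emb f (symA T a) - polyEmb hf (symPoly T a n)‖ ^ 2) =
      normSq f (fun x => symA T a x - trigPoly (symPoly T a n) x) := fun n => by
    have hp := trigPoly_mem_L2 hf (symPoly T a n)
    rw [normSq_eq_norm_emb hf (L2_sub hf hA hp), emb_sub hf hA hp]
    rfl
  simp only [e1]
  set B : ℝ := ∑ ν : Fin T, (2 * ∑' j, ‖vecCoeff T a j ν‖) ^ 2 with hB
  have hlim : Tendsto (fun n => ∫⁻ x, ENNReal.ofReal
      (quad (f x) (symA T a x - trigPoly (symPoly T a n) x)) ∂freq) atTop (𝓝 (∫⁻ _, 0 ∂freq)) := by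
    refine tendsto_lintegral_of_dominated_convergence'
      (fun x => ENNReal.ofReal ((f x).trace.re * B)) (fun n => ?_) (fun n => ?_) ?_ ?_
    · exact aemeasurable_quad hf ((aemeasurable_symA ha).sub (continuous_trigPoly _).aemeasurable)
    · filter_upwards [hf.2] with x hx
      refine ENNReal.ofReal_le_ofReal ?_
      rw [quad_eq_norm hx]
      refine (norm_root_mulVec_sq_le hx _).trans ?_
      have h0 : 0 ≤ (f x).trace.re := (Complex.le_def.1 hx.trace_nonneg).1
      refine mul_le_mul_of_nonneg_left ?_ h0
      rw [EuclideanSpace.norm_sq_eq]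
      refine Finset.sum_le_sum fun ν _ => ?_
      have h1 := norm_symA_le ha x ν
      have h2 := norm_trigPoly_symPoly_le ha n x ν
      have h3 : ‖symA T a x ν - trigPoly (symPoly T a n) x ν‖ ≤ 2 * ∑' j, ‖vecCoeff T a j ν‖ :=
        (norm_sub_le _ _).trans (by linarith)
      simp only [Pi.sub_apply]
      gcongr
    · exact (((integrable_trace hf).mul_const B).lintegral_lt_top).ne
    · refine .of_forall fun x => ?_
      have h1 : Tendsto (fun n => symA T a x - trigPoly (symPoly T a n) x) atTop (𝓝 0) := by
        have h2 : Tendsto (fun n => trigPoly (symPoly T a n) x) atTop (𝓝 (symA T a x)) :=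
          tendsto_pi_nhds.2 fun ν => tendsto_trigPoly_symPoly ha x ν
        simpa using h2.const_sub (symA T a x)
      have h3 := ((continuous_ofReal_quad (f x)).tendsto 0).comp h1
      have e : ENNReal.ofReal (quad (f x) 0) = 0 := by simp [quad]
      rw [e] at h3
      exact h3
  rw [lintegral_zero] at hlim
  have := ENNReal.Tendsto.const_mul (a := ENNReal.ofReal (1 / (2 * Real.pi))) hlim
    (Or.inr ENNReal.ofReal_ne_top)
  rw [mul_zero] at this
  exact this

/-- The partial sums of the functional. -/
lemma partial_sum_ae (hζ : IsPC T P ζ) (a : ℕ → ℂ) (n : ℕ) :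
    ((∑ j ∈ Finset.range n, a (j + 1) • rv hζ ((j + 1 : ℕ) : ℤ) : Lp ℂ 2 P) : Ω → ℂ) =ᵐ[P]
      fun ω => ∑ j ∈ Finset.Icc 1 n, a j * ζ (j : ℤ) ω := by
  have h1 : ∀ j : ℕ, (a (j + 1) • rv hζ ((j + 1 : ℕ) : ℤ) : Lp ℂ 2 P) =ᵐ[P]
      fun ω => a (j + 1) * ζ ((j + 1 : ℕ) : ℤ) ω := by
    intro j
    filter_upwards [Lp.coeFn_smul (a (j + 1)) (rv hζ ((j + 1 : ℕ) : ℤ)),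
      (hζ.memLp ((j + 1 : ℕ) : ℤ)).coeFn_toLp] with ω h1 h2
    rw [h1, Pi.smul_apply, rv, h2, smul_eq_mul]
  refine (Lp.coeFn_finsetSum _ _).trans ?_
  filter_upwards [ae_all_iff.2 h1] with ω hω
  rw [Finset.sum_apply, Finset.sum_congr rfl fun j _ => hω j]
  rw [Finset.range_eq_Ico, Finset.sum_Ico_add' (fun j : ℕ => a j * ζ (j : ℤ) ω) 0 n 1, zero_add]
  rfl

lemma partial_sum_eq_rvPoly (hζ : IsPC T P ζ) (a : ℕ → ℂ) (n : ℕ) :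
    ∑ j ∈ Finset.range (n * T), a (j + 1) • rv hζ ((j + 1 : ℕ) : ℤ) =
      rvPoly hζ (symPoly T a n) := by
  induction n with
  | zero => simp [symPoly]
  | succ n ih =>
    rw [add_mul, one_mul, Finset.sum_range_add, ih, symPoly, symPoly, Finset.sum_range_succ,
      map_add]
    congr 1
    rw [← Fin.sum_univ_eq_sum_range (fun p => a (n * T + p + 1) • rv hζ ((n * T + p + 1 : ℕ) : ℤ))]
    simp only [rvPoly, Finsupp.lsum_single, LinearMap.sum_apply, LinearMap.smulRight_apply,
      LinearMap.proj_apply, vecCoeff, rvBlock]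
    refine Finset.sum_congr rfl fun p _ => ?_
    congr 2
    ring_nf

lemma summable_rv (hT : 0 < T) (hζ : IsPC T P ζ) (hf : IsSpectralDensity f)
    (hd : HasBlockDensity P ζ f) (ha : Summable fun j => ‖a j‖) :
    Summable fun j : ℕ => a (j + 1) • rv hζ ((j + 1 : ℕ) : ℤ) := by
  have hshift : ∀ n ν, ‖rvBlock hζ n ν‖ = ‖rvBlock hζ 0 ν‖ := by
    intro n ν
    have h1 : ∀ n, inner ℂ (rvBlock hζ n ν) (rvBlock hζ n ν) =
        (1 / (2 * Real.pi) : ℂ) * ∫ x, f x ν ν ∂freq := fun n => by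
      rw [inner_rvBlock hζ hf hd, inner_emb hf (expv_mem_L2 hf n ν) (expv_mem_L2 hf n ν)]
      congr 1
      refine integral_congr_ae (.of_forall fun x => ?_)
      simp only [dotProduct_star_expv]
      simp only [expv, smul_vecMul, Pi.smul_apply, single_one_vecMul, smul_eq_mul]
      have := ex_mul_ex_neg n x
      change ex n x * f x ν ν * ex (-n) x = f x ν ν
      linear_combination f x ν ν * this
    have h2 := (h1 n).trans (h1 0).symm
    rw [inner_self_eq_norm_sq_to_K, inner_self_eq_norm_sq_to_K] at h2
    have h3 : ‖rvBlock hζ n ν‖ ^ 2 = ‖rvBlock hζ 0 ν‖ ^ 2 := by exact_mod_cast h2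
    exact (pow_left_inj₀ (norm_nonneg _) (norm_nonneg _) two_ne_zero).1 h3
  have hbd : ∀ j : ℕ, ‖rv hζ ((j + 1 : ℕ) : ℤ)‖ ≤ ∑ ν, ‖rvBlock hζ 0 ν‖ := by
    intro j
    have h1 : rv hζ ((j + 1 : ℕ) : ℤ) =
        rvBlock hζ ((j / T : ℕ) : ℤ) ⟨j % T, Nat.mod_lt _ hT⟩ := by
      rw [rvBlock]
      congr 1
      have := Nat.div_add_mod' j T
      simp only
      exact_mod_cast congrArg (· + 1) this.symm
    rw [h1, hshift]
    exact Finset.single_le_sum (f := fun ν => ‖rvBlock hζ 0 ν‖) (fun _ _ => norm_nonneg _)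
      (Finset.mem_univ _)
  refine Summable.of_norm_bounded
    (((summable_nat_add_iff 1).2 ha).mul_right (∑ ν, ‖rvBlock hζ 0 ν‖)) fun j => ?_
  rw [norm_smul]
  gcongr
  exact hbd j

lemma exists_isFunctional (hT : 0 < T) (hζ : IsPC T P ζ) (hf : IsSpectralDensity f)
    (hd : HasBlockDensity P ζ f) (ha : Summable fun j => ‖a j‖) : ∃ X, IsFunctional P a ζ X := by
  have h := (summable_rv hT hζ hf hd ha).hasSum.tendsto_sum_nat
  set x := ∑' j : ℕ, a (j + 1) • rv hζ ((j + 1 : ℕ) : ℤ)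
  exact ⟨x, Lp.memLp x, (tendsto_msDist_iff (ae_eq_refl _) (partial_sum_ae hζ a)).2 h⟩

lemma tendsto_polyEmb_iff (hf : IsSpectralDensity f) {h : ℝ → Fin T → ℂ} (hh : h ∈ L2 f)
    (p : ℕ → (ℤ →₀ (Fin T → ℂ))) :
    Tendsto (fun n => normSq f (fun x => h x - trigPoly (p n) x)) atTop (𝓝 0) ↔
      Tendsto (fun n => polyEmb hf (p n)) atTop (𝓝 (emb f h)) := by
  rw [← ofReal_mul_norm_sq_tendsto_zero_iff (show (0 : ℝ) < 1 / (2 * Real.pi) by positivity)]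
  refine tendsto_congr fun n => ?_
  have hp := trigPoly_mem_L2 hf (p n)
  rw [normSq_eq_norm_emb hf (L2_sub hf hh hp), emb_sub hf hh hp]
  rfl

lemma exists_isEstimate (hζ : IsPC T P ζ) (hf : IsSpectralDensity f)
    (hd : HasBlockDensity P ζ f) {s : ℕ} {N K : ℕ → ℕ} {h : ℝ → Fin T → ℂ}
    (hh : h ∈ L2s s N K f) : ∃ Y, IsEstimate s N K P ζ f h Y := by
  have hε : ∀ n : ℕ, (0 : ℝ≥0∞) < 2⁻¹ ^ n := fun n => by
    rw [pos_iff_ne_zero]; simp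
  choose p hp hpn using fun n : ℕ => hh.2 (2⁻¹ ^ n) (hε n)
  have hlim : Tendsto (fun n => normSq f (fun x => h x - trigPoly (p n) x)) atTop (𝓝 0) :=
    tendsto_of_tendsto_of_tendsto_of_le_of_le tendsto_const_nhds
      (ENNReal.tendsto_pow_atTop_nhds_zero_of_lt_one (by norm_num)) (fun _ => zero_le)
      fun n => (hpn n).le
  have hcau := ((tendsto_polyEmb_iff hf hh.1 p).1 hlim).cauchySeq
  have hcau' : CauchySeq fun n => rvPoly hζ (p n) := by
    rw [cauchySeq_iff_tendsto_dist_atTop_0] at hcau ⊢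
    have h1 := (((hcau.pow 2).const_mul (1 / (2 * Real.pi)))).sqrt
    simp only [ne_eq, OfNat.ofNat_ne_zero, not_false_eq_true, zero_pow, mul_zero,
      Real.sqrt_zero] at h1
    refine h1.congr fun q => ?_
    rw [dist_eq_norm, dist_eq_norm, ← map_sub, ← map_sub, ← norm_rvPoly_sq hζ hf hd,
      Real.sqrt_sq (norm_nonneg _)]
  obtain ⟨y, hy⟩ := cauchySeq_tendsto_of_complete hcau'
  exact ⟨y, Lp.memLp y, p, hp, hlim,
    (tendsto_msDist_iff (ae_eq_refl _) fun n => rvPoly_ae hζ (p n)).2 hy⟩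

lemma msDist_eq_delta (hT : 0 < T) (hζ : IsPC T P ζ) (hf : IsSpectralDensity f)
    (hd : HasBlockDensity P ζ f) (ha : Summable fun j => ‖a j‖) {s : ℕ} {N K : ℕ → ℕ}
    {h : ℝ → Fin T → ℂ} (hh : h ∈ L2 f) {X Y : Ω → ℂ} (hX : IsFunctional P a ζ X)
    (hY : IsEstimate s N K P ζ f h Y) : msDist P X Y = Delta a h f := by
  obtain ⟨hX2, hXlim⟩ := hX
  obtain ⟨hY2, p, -, hp, hYlim⟩ := hY
  have hx := (tendsto_msDist_iff hX2.coeFn_toLp (partial_sum_ae hζ a)).1 hXlim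
  have hy := (tendsto_msDist_iff hY2.coeFn_toLp fun n => rvPoly_ae hζ (p n)).1 hYlim
  have hx' : Tendsto (fun n => rvPoly hζ (symPoly T a n)) atTop (𝓝 hX2.toLp) := by
    have := hx.comp (tendsto_id.atTop_mul_const' hT)
    refine this.congr fun n => ?_
    simp only [Function.comp, id]
    exact partial_sum_eq_rvPoly hζ a n
  have h1 := ((hx'.sub hy).norm.pow 2)
  have h2 := (((tendsto_polyEmb_symPoly ha hf).sub
    ((tendsto_polyEmb_iff hf hh p).1 hp)).norm.pow 2).const_mul (1 / (2 * Real.pi))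
  have h3 := tendsto_nhds_unique (h1.congr fun n => by
    rw [← map_sub, norm_rvPoly_sq hζ hf hd, map_sub]) h2
  rw [msDist_eq hX2.coeFn_toLp hY2.coeFn_toLp, h3, Delta,
    normSq_eq_norm_emb hf (L2_sub hf (symA_mem_L2 hf ha) hh), emb_sub hf (symA_mem_L2 hf ha) hh]

end Random

end PCExtrap

end

theorem mainTheorem9
    (T : ℕ) (hT : 0 < T) (s : ℕ) (N K : ℕ → ℕ)
    (a : ℕ → ℂ) (ha : Summable (fun j => ‖a j‖))
    (D : Set (ℝ → Matrix (Fin T) (Fin T) ℂ))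
    (hdens : ∀ f ∈ D, PCExtrap.IsSpectralDensity f)
    (hmin : ∀ f ∈ D, PCExtrap.IsMinimal f)
    (c : (ℝ → Matrix (Fin T) (Fin T) ℂ) → ℤ → Fin T → ℂ)
    (hc : ∀ f ∈ D, PCExtrap.IsBInv s N K f (PCExtrap.extCoeff T a) (c f))
    (f₀ : ℝ → Matrix (Fin T) (Fin T) ℂ) (hf₀ : f₀ ∈ D)
    (hmax : ∀ f ∈ D, (PCExtrap.pair (c f) (PCExtrap.extCoeff T a)).re ≤
      (PCExtrap.pair (c f₀) (PCExtrap.extCoeff T a)).re) :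
    -- `Δ(h; f)` is the mean square error of the estimate with spectral characteristic `h`
    (∀ (Ω : Type*) [MeasurableSpace Ω] (P : MeasureTheory.Measure Ω)
        [MeasureTheory.IsProbabilityMeasure P] (ζ : ℤ → Ω → ℂ),
        PCExtrap.IsPC T P ζ → ∀ f ∈ D, PCExtrap.HasBlockDensity P ζ f →
        (∃ X, PCExtrap.IsFunctional P a ζ X) ∧
        ∀ h ∈ PCExtrap.L2s s N K f, (∃ Y, PCExtrap.IsEstimate s N K P ζ f h Y) ∧
          ∀ X Y, PCExtrap.IsFunctional P a ζ X → PCExtrap.IsEstimate s N K P ζ f h Y →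
            PCExtrap.msDist P X Y = PCExtrap.Delta a h f) ∧
    -- `f₀` is least favorable
    PCExtrap.IsLeastFavorable s N K a D f₀ ∧
    -- the formula for the spectral characteristic makes sense, it is the optimal one for `f₀`,
    -- and it is minimax if it belongs to `H_D`
    (∃ C, PCExtrap.HasFourierSeries C (c f₀)) ∧
    ∀ C, PCExtrap.HasFourierSeries C (c f₀) →
      PCExtrap.IsOptimal s N K a f₀ (PCExtrap.specChar a f₀ C) ∧
      (Convex ℝ D → PCExtrap.specChar a f₀ C ∈ PCExtrap.HD s N K D →
        PCExtrap.IsMinimax s N K a D (PCExtrap.specChar a f₀ C)) := by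
  refine ⟨fun Ω _ P _ ζ hζ f hf hd => ?_, ⟨hf₀, fun f hf => ?_⟩, ?_, fun C hC => ?_⟩
  · refine ⟨PCExtrap.exists_isFunctional hT hζ (hdens f hf) hd ha, fun h hh => ⟨?_, ?_⟩⟩
    · exact PCExtrap.exists_isEstimate hζ (hdens f hf) hd hh
    · exact fun X Y hX hY => PCExtrap.msDist_eq_delta hT hζ (hdens f hf) hd ha hh.1 hX hY
  · rw [PCExtrap.deltaOpt_eq ha (hdens f hf) (hmin f hf) (hc f hf),
      PCExtrap.deltaOpt_eq ha (hdens f₀ hf₀) (hmin f₀ hf₀) (hc f₀ hf₀)]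
    exact ENNReal.ofReal_le_ofReal (hmax f hf)
  · obtain ⟨⟨C, -, hC, -⟩, -⟩ := (hc f₀ hf₀).exists_function (hdens f₀ hf₀) (hmin f₀ hf₀)
    exact ⟨C, hC⟩
  · have hopt := PCExtrap.isOptimal_specChar ha (hdens f₀ hf₀) (hmin f₀ hf₀) (hc f₀ hf₀) hC
    refine ⟨hopt, fun hD hHD => ?_⟩
    have hsaddle : ∀ f ∈ D, PCExtrap.Delta a (PCExtrap.specChar a f₀ C) f ≤
        PCExtrap.Delta a (PCExtrap.specChar a f₀ C) f₀ := fun f hf =>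
      PCExtrap.delta_le_of_convex ha hdens hmin hc hf₀ hmax hD hC hf
    refine ⟨hHD, ⟨f₀, hf₀, hsaddle⟩, fun h hh => ?_⟩
    exact (iSup₂_le hsaddle).trans ((hopt.2 h (hh f₀ hf₀)).trans
      (le_iSup₂ (f := fun f (_ : f ∈ D) => PCExtrap.Delta a h f) f₀ hf₀))
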